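/- Let $F$ be a non-Archimedean local field of any characteristic with ring of integers $\mathfrak o$, maximal ideal $\pi\mathfrak o$, residue field $\kappa$ and $q=\#\kappa$. Let $\gamma\in \mathfrak{gl}_n(\mathfrak o)$ be regular semisimple, i.e. its characteristic polynomial $\chi_\gamma(x)=x^n+c_1x^{n-1}+\cdots+c_n$ is separable, and suppose $c_n\neq 0$. Put $L=\mathfrak o^n$, identify $\mathfrak{gl}_n(\mathfrak o)=\mathrm{End}_{\mathfrak o}(L)$, let $\varphi_n:\mathfrak{gl}_n\to\mathbb A^n$ send $X$ to the coefficients $(c_1,\dots,c_n)$ of its characteristic polynomial, and let $G_\gamma(F)=\{X\in\mathfrak{gl}_n(F):\varphi_n(X)=\varphi_n(\gamma)\}$ and $\underline G_\gamma(\mathfrak o)=G_\gamma(F)\cap\mathfrak{gl}_n(\mathfrak o)$. Let $|\omega|$ be the measure on the $F$-analytic manifold $G_\gamma(F)$ attached to the quotient form $\omega=\omega_{\mathfrak{gl}_n}/\varphi_n^*\omega_{\mathbb A^n}$, where $\omega_{\mathfrak{gl}_n}$, $\omega_{\mathbb A^n}$ are the invariant top forms giving $\mathfrak{gl}_n(\mathfrak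 o)$ and $\mathfrak o^n$ volume $1$, and let $\mathcal{SO}_\gamma=\int_{\underline G_\gamma(\mathfrak o)}|\omega|$. A sublattice $M\subset L$ has type $k=(k_1,\dots,k_{n-m})$, where $1\le k_1\le\cdots\le k_{n-m}$ and $0\le m\le n$, if $L/M\cong\bigoplus_i\mathfrak o/\pi^{k_i}\mathfrak o$. Let $c_k$ be the number of sublattices of $L$ of type $k$. For a sublattice $M$ let $\mathcal{SO}_{\gamma,M}$ be the $|\omega|$-volume of $\{f\in\underline G_\gamma(\mathfrak o): f(L)=M\}$. Let $\overline M=M/(M\cap\pi L)\subset L/\pi L$, and for a $\kappa$-subspace $V\subset\overline M$ let $\mathcal{SO}_{\gamma,M,V}$ be the $|\omega|$-volume of $\{f\in\underline G_\gamma(\mathfrak o): f(L)=M,\ \bar f(\overline M)=V\}$, where $\bar f:\overline M\to\overline M$ is the map induced by $f$. Let $\#\mathrm{Gr}_\kappa(a,b)$ be the number of $a$-dimensional subspaces of $\kappa^b$. 1. $\mathcal{SO}_{\gamma,M}$ depends only on the type $k$ of $M$; write it $\mathcal{SO}_{\gamma,k}$. Then $$\mathcal{SO}_\gamma=\sum_{\substack{k=(k_1,\dots,k_{n-m}),\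 m\ge 0\\ \sum k_i=\mathrm{ord}(c_n)}}c_k\cdot\mathcal{SO}_{\gamma,k}.$$ 2. If $k=(r_1,\dots,r_1,\dots,r_l,\dots,r_l)$ with $0=r_0<r_1<\cdots<r_l$, where $r_i$ occurs $m_i\ge1$ times for $1\le i\le l$, and if $m_0=m$ (so $\sum_{i=0}^l m_i=n$) and $s_i=\sum_{j=0}^i m_j$, then $$c_k=\prod_{i=1}^l\#\mathrm{Gr}_\kappa(m_i,s_i)\cdot q^{\left((r_i-r_{i-1}-1)(n-s_{i-1})+(n-s_i)\right)s_{i-1}}.$$ 3. For $M$ of type $k=(k_1,\dots,k_{n-m})$ and $V\subset\overline M$ of dimension $m-t$, $\mathcal{SO}_{\gamma,M,V}$ depends only on $k$ and $t$; write it $\mathcal{SO}_{\gamma,k,t}$. The number $d_t$ of subspaces of $\overline M$ of dimension $m-t$ is $\#\mathrm{Gr}_\kappa(t,m)$. 4. Suppose moreover that $\chi_\gamma(x)\equiv x^n$ modulo $\pi$. Then for every type $k=(k_1,\dots,k_{n-m})$ with $\sum k_i=\mathrm{ord}(c_n)$ and $m\ge1$ one has $\mathcal{SO}_{\gamma,k}=\sum_{t=1}^{n-m}d_t\cdot\mathcal{SO}_{\gamma,k,t}$,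 and $$\mathcal{SO}_\gamma=\sum_{\substack{k=(k_1,\dots,k_{n-m}),\ m\ge1\\ \sum k_i=\mathrm{ord}(c_n)}}c_k\cdot\Bigl(\sum_{t=1}^{n-m}d_t\cdot\mathcal{SO}_{\gamma,k,t}\Bigr)+\sum_{\substack{k=(k_1,\dots,k_n)\\ \sum k_i=\mathrm{ord}(c_n)}}c_k\cdot\mathcal{SO}_{\gamma,k}.$$ -/

import Mathlib

open scoped ENNReal NNReal ValuativeRel Polynomial WithZero
open MeasureTheory

namespace GLOrbital

noncomputable section

/-! ### The adjoint quotient `gl_n → 𝔸ⁿ` and its differential -/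

section AdjointQuotient

variable {n : ℕ}

/-- The map `φ_n` (on `R`-points): `X ↦ (c₁, …, c_n)`, where
`xⁿ + c₁ xⁿ⁻¹ + ⋯ + c_n` is the characteristic polynomial of `X`.
The entry with index `i : Fin n` is `c_{i+1}`. -/
def charCoeffs {R : Type*} [CommRing R] (X : Matrix (Fin n) (Fin n) R) : Fin n → R :=
  fun i => X.charpoly.coeff (n - 1 - i)

/-- The differential of `φ_n` at `X` applied to the tangent vector `Y`, i.e. the `ε`-part of
`φ_n (X + ε Y)` over the dual numbers. -/
def charCoeffsDeriv {R : Type*} [CommRing R] (X Y : Matrix (Fin n) (Fin n) R) : Fin n → R :=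
  fun i => TrivSqZeroExt.snd
    (charCoeffs (X.map (TrivSqZeroExt.inl : R → DualNumber R) +
      Y.map (TrivSqZeroExt.inr : R → DualNumber R)) i)

/-- The `n² - n` off-diagonal positions of an `n × n` matrix, used only as an index set of
cardinality `n² - n = dim G_γ`. -/
abbrev OffDiag (n : ℕ) : Type := {a : Fin n × Fin n // a.1 ≠ a.2}

/-- For a linear map `p : gl_n(F) → F^{n²-n}`, the determinant, with respect to the matrix entries
on the source and the standard coordinates on the target, of the linear map
`(dφ_n at X, p) : gl_n(F) → Fⁿ × F^{n²-n}`.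
The rows for `Fⁿ` are put at the diagonal positions and those for `F^{n²-n}` at the off-diagonal
ones; another ordering changes the determinant at most by a sign. -/
def jacobian {F : Type*} [Field F] (p : Matrix (Fin n) (Fin n) F →ₗ[F] (OffDiag n → F))
    (X : Matrix (Fin n) (Fin n) F) : F :=
  Matrix.det (Matrix.of fun a b : Fin n × Fin n =>
    if h : a.1 = a.2 then charCoeffsDeriv X (Matrix.single b.1 b.2 1) a.1
    else p (Matrix.single b.1 b.2 1) ⟨a, h⟩)

end AdjointQuotient

/-! ### The measure attached to the quotient form on a fibre of the adjoint quotient -/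

section Measure

instance matrixMeasurableSpace (E : Type*) [TopologicalSpace E] (n : ℕ) :
    MeasurableSpace (Matrix (Fin n) (Fin n) E) := borel _

variable (F : Type*) [Field F] [ValuativeRel F] [TopologicalSpace F] [IsNonarchimedeanLocalField F]

theorem card_residueField_ne_zero :
    ((Nat.card (IsLocalRing.ResidueField 𝒪[F]) : ℕ) : ℝ≥0) ≠ 0 := by
  have : Finite (IsLocalRing.ResidueField 𝒪[F]) :=
    inferInstanceAs (Finite 𝓀[F])
  exact_mod_cast Nat.card_pos.ne'

variable {F} in
/-- The normalised absolute value `|x| = q^{-ord x}`, where `q` is the cardinality of the residue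
field. -/
def normAbs (x : F) : ℝ≥0 :=
  WithZeroMulInt.toNNReal (card_residueField_ne_zero F)
    (IsNonarchimedeanLocalField.valueGroupWithZeroIsoInt F (ValuativeRel.valuation F x))

variable [MeasurableSpace F] [BorelSpace F]

/-- The Haar measure on `F` giving the ring of integers volume `1`. -/
def haarF : Measure F :=
  (Measure.addHaar (𝒪[F] : Set F))⁻¹ • (Measure.addHaar : Measure F)

variable {F} {n : ℕ}

/-- `G_a(F)`: the `F`-points of the fibre of the adjoint quotient over `a`. -/
def fibre (a : Fin n → F) : Set (Matrix (Fin n) (Fin n) F) := {X | charCoeffs X = a}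

/-- `(U, p)` is a chart of the `F`-analytic manifold `G_a(F)`: `U` is an open subset of `G_a(F)`,
the linear map `p` is injective on `U`, and `(dφ_n, p)` is invertible at every point of `U`
(so that `p` restricts to an isomorphism of the tangent space of `G_a(F)` with `F^{n²-n}`). -/
structure IsChart (a : Fin n → F) (p : Matrix (Fin n) (Fin n) F →ₗ[F] (OffDiag n → F))
    (U : Set (Matrix (Fin n) (Fin n) F)) : Prop where
  isOpen : ∃ W : Set (Matrix (Fin n) (Fin n) F), IsOpen W ∧ U = fibre a ∩ W
  injOn : Set.InjOn p U
  jacobian_ne_zero : ∀ X ∈ U, jacobian p X ≠ 0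

/-- The measure `|ω|` on a chart `(U, p)`, where `ω = ω_{gl_n} / φ_n^* ω_{𝔸ⁿ}`, extended by zero.
Since `φ_n^* (dc₁ ∧ ⋯ ∧ dc_n) ∧ p^* dy = ± jacobian p X • ω_{gl_n}`, the form `ω` is
`± p^* dy / jacobian p X` in this chart, so `|ω|` is `|jacobian p X|⁻¹` times the pull-back along
`p` of the Haar measure `dy` of `F^{n²-n}`. -/
def chartMeasure (p : Matrix (Fin n) (Fin n) F →ₗ[F] (OffDiag n → F))
    (U : Set (Matrix (Fin n) (Fin n) F)) : Measure (Matrix (Fin n) (Fin n) F) :=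
  ((Measure.comap (fun X : U => p X.1) (Measure.pi fun _ : OffDiag n => haarF F)).map
    Subtype.val).withDensity fun X => (normAbs (jacobian p X) : ℝ≥0∞)⁻¹

/-- The measure `|ω_a^{ld}|` on the fibre `G_a(F)` (as a measure on `gl_n(F)` supported on
`G_a(F)`) attached to the quotient `ω_{gl_n} / φ_n^* ω_{𝔸ⁿ}` of the invariant forms for which
`gl_n(𝒪)` and `𝒪ⁿ` have volume `1`. The local expressions in the charts agree on overlaps; the
measure glued from them is their supremum. -/
def formMeasure (a : Fin n → F) : Measure (Matrix (Fin n) (Fin n) F) :=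
  ⨆ (p : Matrix (Fin n) (Fin n) F →ₗ[F] (OffDiag n → F))
    (U : Set (Matrix (Fin n) (Fin n) F)) (_ : IsChart a p U), chartMeasure p U

end Measure

/-! ### Sublattices of `L = 𝒪ⁿ`, their types and reductions -/

section Lattices

variable {R : Type*} [CommRing R] [IsLocalRing R] {n : ℕ}

/-- `M ⊆ L = Rⁿ` has type `k = (k₁, …, k_r)`: all `kᵢ ≥ 1` and
`L / M ≅ ⊕ᵢ R / 𝔪^{kᵢ}`. A nondecreasing tuple is the same thing as a multiset. -/
def HasType (M : Submodule R (Fin n → R)) (k : Multiset ℕ) : Prop :=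
  (∀ i ∈ k, 1 ≤ i) ∧
    Nonempty (((Fin n → R) ⧸ M) ≃ₗ[R]
      (∀ i : k.ToType, R ⧸ (IsLocalRing.maximalIdeal R ^ (i.1 : ℕ))))

variable (R n) in
/-- `c_k`, the number of sublattices of `L = Rⁿ` of type `k`. -/
def typeCount (k : Multiset ℕ) : ℕ :=
  Nat.card {M : Submodule R (Fin n → R) // HasType M k}

variable (R n) in
/-- Some sublattice of type `k` (an arbitrary submodule if there is none). -/
def typeRep (k : Multiset ℕ) : Submodule R (Fin n → R) :=
  Classical.epsilon fun M => HasType M k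

variable (R n) in
/-- The reduction map `L = Rⁿ → L / 𝔪 L = κⁿ`. -/
def reduceVec : (Fin n → R) →ₛₗ[IsLocalRing.residue R] (Fin n → IsLocalRing.ResidueField R) where
  toFun v i := IsLocalRing.residue R (v i)
  map_add' v w := by ext i; simp
  map_smul' c v := by ext i; simp

/-- `M̄ = M / (M ∩ 𝔪 L)`, as a subspace of `L̄ = κⁿ`. -/
def reduceLattice (M : Submodule R (Fin n → R)) :
    Submodule (IsLocalRing.ResidueField R) (Fin n → IsLocalRing.ResidueField R) :=
  haveI : RingHomSurjective (IsLocalRing.residue R) := ⟨IsLocalRing.residue_surjective⟩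
  M.map (reduceVec R n)

/-- `V` is a subspace of `M̄` of dimension `m - t`, where `n - m` is the length of the type `k`
of `M`. -/
def IsSubspaceOfCodim (M : Submodule R (Fin n → R)) (k : Multiset ℕ) (t : ℕ)
    (V : Submodule (IsLocalRing.ResidueField R) (Fin n → IsLocalRing.ResidueField R)) : Prop :=
  V ≤ reduceLattice M ∧
    Module.finrank (IsLocalRing.ResidueField R) V + t + Multiset.card k = n

/-- The number of subspaces of `M̄` of dimension `m - t`. -/
def subspaceCount (M : Submodule R (Fin n → R)) (k : Multiset ℕ) (t : ℕ) : ℕ :=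
  Nat.card {V : Submodule (IsLocalRing.ResidueField R) (Fin n → IsLocalRing.ResidueField R) //
    IsSubspaceOfCodim M k t V}

/-- `#Gr_κ(a, b)`: the number of `a`-dimensional subspaces of `κᵇ`. -/
def grCard (κ : Type*) [Field κ] (a b : ℕ) : ℕ :=
  Nat.card {W : Submodule κ (Fin b → κ) // Module.finrank κ W = a}

/-- `𝓛(L, M)(R)`: the endomorphisms of `L` with image `M`, i.e. the surjections `L → M`. -/
def homSet (M : Submodule R (Fin n → R)) : Set (Matrix (Fin n) (Fin n) R) :=
  {f | LinearMap.range f.mulVecLin = M}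

/-- `𝓛(L, M, V)(R)`: the `f ∈ 𝓛(L, M)(R)` for which the induced map `f̄ : M̄ → M̄`
has image `V`. -/
def homSetSub (M : Submodule R (Fin n → R))
    (V : Submodule (IsLocalRing.ResidueField R) (Fin n → IsLocalRing.ResidueField R)) :
    Set (Matrix (Fin n) (Fin n) R) :=
  {f | f ∈ homSet M ∧
    (reduceLattice M).map (f.map (IsLocalRing.residue R)).mulVecLin = V}

end Lattices

/-! ### Stable orbital integrals and their strata -/

section OrbitalIntegrals

variable {F : Type*} [Field F] [ValuativeRel F] [TopologicalSpace F]
  [IsNonarchimedeanLocalField F] [MeasurableSpace F] [BorelSpace F] {n : ℕ}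

/-- `G_γ(𝒪)`: the integral matrices with the same characteristic polynomial as `γ`. -/
def integralFibre (γ : Matrix (Fin n) (Fin n) 𝒪[F]) : Set (Matrix (Fin n) (Fin n) 𝒪[F]) :=
  {f | charCoeffs f = charCoeffs γ}

/-- The volume of a subset `S` of `G_γ(𝒪) ⊆ G_γ(F)` with respect to `|ω_{χ_γ}^{ld}|`. -/
def orbitVolume (γ : Matrix (Fin n) (Fin n) 𝒪[F]) (S : Set (Matrix (Fin n) (Fin n) 𝒪[F])) :
    ℝ≥0∞ :=
  formMeasure (charCoeffs (γ.map (algebraMap 𝒪[F] F)))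
    ((fun f => f.map (algebraMap 𝒪[F] F)) '' S)

/-- The stable orbital integral `𝒮𝒪_γ`. -/
def stableOrbital (γ : Matrix (Fin n) (Fin n) 𝒪[F]) : ℝ≥0∞ :=
  orbitVolume γ (integralFibre γ)

/-- `𝒮𝒪_{γ, 𝓛(L, M)}`: the volume of `O_{γ, 𝓛(L, M)} = G_γ(𝒪) ∩ 𝓛(L, M)(𝒪)`. -/
def stableOrbitalLattice (γ : Matrix (Fin n) (Fin n) 𝒪[F])
    (M : Submodule 𝒪[F] (Fin n → 𝒪[F])) : ℝ≥0∞ :=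
  orbitVolume γ (integralFibre γ ∩ homSet M)

/-- `𝒮𝒪_{γ, 𝓛(L, M, V)}`: the volume of `O_{γ, 𝓛(L, M, V)} = G_γ(𝒪) ∩ 𝓛(L, M, V)(𝒪)`. -/
def stableOrbitalSub (γ : Matrix (Fin n) (Fin n) 𝒪[F])
    (M : Submodule 𝒪[F] (Fin n → 𝒪[F]))
    (V : Submodule (IsLocalRing.ResidueField 𝒪[F]) (Fin n → IsLocalRing.ResidueField 𝒪[F])) :
    ℝ≥0∞ :=
  orbitVolume γ (integralFibre γ ∩ homSetSub M V)

/-- `𝒮𝒪_{γ, k}`: the value of `𝒮𝒪_{γ, 𝓛(L, M)}` for a lattice `M` of type `k`. -/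
def stableOrbitalType (γ : Matrix (Fin n) (Fin n) 𝒪[F]) (k : Multiset ℕ) : ℝ≥0∞ :=
  stableOrbitalLattice γ (typeRep 𝒪[F] n k)

/-- `𝒮𝒪_{γ, k, t}`: the value of `𝒮𝒪_{γ, 𝓛(L, M, V)}` for a lattice `M` of type `k` and a
subspace `V` of `M̄` of dimension `m - t`. -/
def stableOrbitalTypeCodim (γ : Matrix (Fin n) (Fin n) 𝒪[F]) (k : Multiset ℕ) (t : ℕ) : ℝ≥0∞ :=
  stableOrbitalSub γ (typeRep 𝒪[F] n k)
    (Classical.epsilon fun V => IsSubspaceOfCodim (typeRep 𝒪[F] n k) k t V)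

variable (F n) in
/-- `d_t`: the number of subspaces of dimension `m - t` of `M̄`, for a lattice `M` of type `k`. -/
def subspaceCountType (k : Multiset ℕ) (t : ℕ) : ℕ :=
  subspaceCount (typeRep 𝒪[F] n k) k t

end OrbitalIntegrals

end

end GLOrbital

open GLOrbital

/-!
The proof never evaluates the measure `|ω|`: it uses only that `|ω|` is a measure and that it is
invariant under conjugation.

*Invariance.* `Ad g` preserves the fibres of the adjoint quotient and the characteristic
polynomial, and `det (Ad g) = 1`, so it carries a chart to a chart with the same Jacobian
(`jacobian_conjLin`), and the supremum over all charts is unchanged (`formMeasure_conj_image`).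

*Independence of `M` and `V`.* By elementary divisors, `GL_n(𝒪)` acts transitively on the
sublattices of a given type (`HasType.exists_units_map_eq`). The stabiliser of `M` acts transitively
on the subspaces of `M̄` of a given dimension: an automorphism of `κⁿ` congruent to `1` modulo `M̄`
lifts to an automorphism of `L` congruent to `1` modulo `M` (`exists_units_map_eq_of_finrank_eq`).
Conjugation by `g` carries `𝓛(L, M, V)` to `𝓛(L, gM, ḡV)`.

*Summation.* `G_γ(𝒪)` is the disjoint union of its intersections with the sets `𝓛(L, M)`, where the
type of `M` is a partition of `ord (det f) = ord c_n` (`HasType.addVal_det`). There are finitely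
many such `M`, and each `𝓛(L, M)`, being a translate `φ GL_n(𝒪)`, is compact, hence measurable. If
`χ_γ ≡ xⁿ`, then `f̄` is nilpotent, which bounds the codimension `t` of `f̄(M̄)` in `M̄` by
`1 ≤ t ≤ n - m` and gives the refined formula.

*Counting.* The lattices of type `k` are counted by way of `M ↦ (M : π)`. If `M` has type `k`, then
`(M : π)` has the type `k'` obtained by lowering every part by `1`; and for fixed `N = φ(L)` of type
`k'`, the `M` of type `k` with `(M : π) = N` correspond to the `m`-dimensional subspaces of `κⁿ`
that meet `ker φ̄` trivially (`natCard_lowerLattice_eq`). If `m'` is the rank of `φ̄`, there are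
`#Gr(m, m') q^{m (n - m')}` of these, whence the recursion
`typeCount_eq_typeCount_predParts_mul`, and the closed formula by induction on the largest part.
-/

namespace GLOrbital

/-! ### Conjugation and the Jacobian of a chart -/

section AdjointQuotient

variable {R : Type*} [CommRing R] {n : ℕ}

theorem charCoeffs_map {S : Type*} [CommRing S] (f : R →+* S) (X : Matrix (Fin n) (Fin n) R) :
    charCoeffs (X.map f) = fun i => f (charCoeffs X i) := by
  ext i
  simp [charCoeffs, Matrix.charpoly_map]

theorem charCoeffs_units_conj (g : (Matrix (Fin n) (Fin n) R)ˣ) (X : Matrix (Fin n) (Fin n) R) :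
    charCoeffs (g.1 * X * g⁻¹.1) = charCoeffs X := by
  ext i
  simp only [charCoeffs]
  rw [Matrix.coe_units_inv, Matrix.charpoly_units_conj]

/-- The differential of the adjoint quotient is linear in the tangent vector. Over the
square-zero extension of `R` by the functionals on `gl_n(R)` there is a generic tangent vector, of
which every tangent vector is a specialisation; so `charCoeffsDeriv X` is evaluation of the
functionals that make up its `ε`-part. -/
theorem exists_linearMap_eq_charCoeffsDeriv (X : Matrix (Fin n) (Fin n) R) :
    ∃ D : Matrix (Fin n) (Fin n) R →ₗ[R] (Fin n → R), ∀ Y, charCoeffsDeriv X Y = D Y := by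
  let M := Matrix (Fin n) (Fin n) R →ₗ[R] R
  let gen : Matrix (Fin n) (Fin n) (TrivSqZeroExt R M) :=
    X.map TrivSqZeroExt.inl + Matrix.of fun i j =>
      TrivSqZeroExt.inr (Matrix.entryLinearMap R R i j)
  refine ⟨LinearMap.pi fun i => TrivSqZeroExt.snd (charCoeffs gen i), fun Y => ?_⟩
  let ev : TrivSqZeroExt R M →ₐ[R] DualNumber R := TrivSqZeroExt.map (LinearMap.applyₗ Y)
  have key : gen.map ev = X.map (TrivSqZeroExt.inl : R → DualNumber R) +
      Y.map (TrivSqZeroExt.inr : R → DualNumber R) := by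
    ext i j <;> simp [gen, ev, M]
  ext i
  simp only [charCoeffsDeriv]
  rw [← key]
  have := congrFun (charCoeffs_map (ev : TrivSqZeroExt R M →+* DualNumber R) gen) i
  simp only [RingHom.coe_coe] at this
  rw [this]
  simp [ev]
  rfl

theorem charCoeffsDeriv_units_conj (g : (Matrix (Fin n) (Fin n) R)ˣ)
    (X Y : Matrix (Fin n) (Fin n) R) :
    charCoeffsDeriv (g.1 * X * g⁻¹.1) (g.1 * Y * g⁻¹.1) = charCoeffsDeriv X Y := by
  let G : (Matrix (Fin n) (Fin n) (DualNumber R))ˣ :=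
    Units.map (RingHom.mapMatrix (TrivSqZeroExt.inlHom R R)).toMonoidHom g
  have hinr : ∀ A B C : Matrix (Fin n) (Fin n) R,
      (A * B * C).map (TrivSqZeroExt.inr : R → DualNumber R) =
        A.map (TrivSqZeroExt.inl : R → DualNumber R) * B.map TrivSqZeroExt.inr *
          C.map TrivSqZeroExt.inl := by
    intro A B C
    refine Matrix.ext fun i j => ?_
    simp only [Matrix.mul_apply, Matrix.map_apply, TrivSqZeroExt.inl_mul_inr,
      ← TrivSqZeroExt.inr_sum, TrivSqZeroExt.inr_mul_inl, smul_eq_mul, MulOpposite.smul_eq_mul_unop,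
      MulOpposite.unop_op]
  have hinl : ∀ A B C : Matrix (Fin n) (Fin n) R,
      (A * B * C).map (TrivSqZeroExt.inl : R → DualNumber R) =
        A.map (TrivSqZeroExt.inl : R → DualNumber R) * B.map TrivSqZeroExt.inl *
          C.map TrivSqZeroExt.inl := by
    intro A B C
    have := map_mul (RingHom.mapMatrix (m := Fin n) (TrivSqZeroExt.inlHom R R)) (A * B) C
    rw [map_mul (RingHom.mapMatrix (m := Fin n) (TrivSqZeroExt.inlHom R R)) A] at this
    exact this
  ext i
  simp only [charCoeffsDeriv]
  rw [hinr, hinl, ← add_mul, ← mul_add]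
  exact congrArg TrivSqZeroExt.snd (congrFun (charCoeffs_units_conj G _) i)

/-- Conjugation by a unit, as a linear automorphism of the space of matrices. -/
def conjLin (g : (Matrix (Fin n) (Fin n) R)ˣ) :
    Matrix (Fin n) (Fin n) R ≃ₗ[R] Matrix (Fin n) (Fin n) R where
  toFun X := g.1 * X * g⁻¹.1
  invFun X := g⁻¹.1 * X * g.1
  map_add' X Y := by simp [mul_add, add_mul]
  map_smul' c X := by simp
  left_inv X := by simp [← mul_assoc]
  right_inv X := by simp [← mul_assoc]

theorem conjLin_apply (g : (Matrix (Fin n) (Fin n) R)ˣ) (X : Matrix (Fin n) (Fin n) R) :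
    conjLin g X = g.1 * X * g⁻¹.1 := rfl

theorem conjLin_symm (g : (Matrix (Fin n) (Fin n) R)ˣ) : (conjLin g).symm = conjLin g⁻¹ := by
  ext X : 1
  simp [conjLin]

open scoped Kronecker in
/-- The Jacobian is unchanged when a chart is transported by conjugation: the transport multiplies
it by the determinant of `Ad g⁻¹`, which is `det (g⁻¹ ⊗ gᵀ) = 1`. -/
theorem jacobian_conjLin {F : Type*} [Field F] (g : (Matrix (Fin n) (Fin n) F)ˣ)
    (p : Matrix (Fin n) (Fin n) F →ₗ[F] (OffDiag n → F)) (X : Matrix (Fin n) (Fin n) F) :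
    jacobian (p ∘ₗ (conjLin g).symm.toLinearMap) (conjLin g X) = jacobian p X := by
  obtain ⟨D, hD⟩ := exists_linearMap_eq_charCoeffsDeriv X
  have hD' : ∀ Y, charCoeffsDeriv (conjLin g X) Y = D ((conjLin g).symm Y) := by
    intro Y
    rw [← hD, ← charCoeffsDeriv_units_conj g X, ← conjLin_apply, ← conjLin_apply,
      LinearEquiv.apply_symm_apply]
  let A : Matrix (Fin n × Fin n) (Fin n × Fin n) F := (g⁻¹.1 : Matrix _ _ F) ⊗ₖ g.1.transpose
  have hA : A.det = 1 := by
    rw [Matrix.det_kronecker, Matrix.det_transpose, ← mul_pow, ← Matrix.det_mul]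
    simp
  have hsingle : ∀ b : Fin n × Fin n, (conjLin g).symm (Matrix.single b.1 b.2 1) =
      ∑ c : Fin n × Fin n, A c b • Matrix.single c.1 c.2 (1 : F) := by
    intro b
    rw [conjLin_symm, conjLin_apply, Matrix.matrix_eq_sum_single (_ * _), Fintype.sum_prod_type]
    refine Finset.sum_congr rfl fun i _ => Finset.sum_congr rfl fun j _ => ?_
    simp only [A, Matrix.kroneckerMap_apply, Matrix.smul_single, smul_eq_mul, mul_one,
      Matrix.transpose_apply, inv_inv]
    congr 1
    simp [Matrix.mul_apply, Matrix.single_apply, ite_and]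
  unfold jacobian
  refine Eq.trans ?_ ((Matrix.det_mul _ A).trans ((congrArg _ hA).trans (mul_one _)))
  congr 1
  ext a b
  rw [Matrix.mul_apply]
  by_cases h : a.1 = a.2
  · simp only [Matrix.of_apply, h, dif_pos, hD, hD', hsingle, map_sum, map_smul,
      Finset.sum_apply, Pi.smul_apply, smul_eq_mul, mul_comm (A _ _)]
  · simp only [Matrix.of_apply, h, dif_neg, not_false_eq_true, LinearMap.comp_apply,
      LinearEquiv.coe_coe, hsingle, map_sum, map_smul, Finset.sum_apply, Pi.smul_apply,
      smul_eq_mul, mul_comm (A _ _)]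

end AdjointQuotient

/-! ### Invariance of the measure under conjugation -/

section Measure

theorem _root_.MeasurableEquiv.map_withDensity_comp {α β : Type*} [MeasurableSpace α]
    [MeasurableSpace β] (e : α ≃ᵐ β) (μ : Measure α) (f : β → ℝ≥0∞) :
    (μ.withDensity (f ∘ e)).map e = (μ.map e).withDensity f := by
  ext s hs
  rw [e.map_apply, withDensity_apply _ (e.measurable hs), withDensity_apply _ hs, e.restrict_map,
    lintegral_map_equiv]
  rfl

theorem _root_.MeasurableEquiv.comap_comp_measurableEquiv {α β γ : Type*} [MeasurableSpace α]
    [MeasurableSpace β] [MeasurableSpace γ] (e : α ≃ᵐ β) (f : β → γ) (μ : Measure γ) :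
    (μ.comap (f ∘ e)).map e = μ.comap f := by
  by_cases h : Function.Injective f ∧ ∀ s, MeasurableSet s → NullMeasurableSet (f '' s) μ
  · ext s hs
    rw [e.map_apply, Measure.comap_apply₀ _ _ (h.1.comp e.injective) _
      (e.measurable hs).nullMeasurableSet, Measure.comap_apply₀ _ _ h.1 h.2 hs.nullMeasurableSet,
      Set.image_comp, Set.image_preimage_eq _ e.surjective]
    intro t ht
    rw [Set.image_comp]
    exact h.2 _ (e.measurableSet_image.2 ht)
  · rw [Measure.comap_undef h, Measure.comap_undef, Measure.map_zero]
    refine fun h' => h ⟨fun x y hxy => ?_, fun t ht => ?_⟩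
    · obtain ⟨x, rfl⟩ := e.surjective x
      obtain ⟨y, rfl⟩ := e.surjective y
      rw [h'.1 hxy]
    · have := h'.2 _ (e.measurable ht)
      rwa [Set.image_comp, Set.image_preimage_eq _ e.surjective] at this

instance matrixBorelSpace (E : Type*) [TopologicalSpace E] (n : ℕ) :
    BorelSpace (Matrix (Fin n) (Fin n) E) := ⟨rfl⟩

theorem conjLin_mem_fibre {F : Type*} [Field F] {n : ℕ} (g : (Matrix (Fin n) (Fin n) F)ˣ)
    {a : Fin n → F} {X : Matrix (Fin n) (Fin n) F} : conjLin g X ∈ fibre a ↔ X ∈ fibre a := by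
  simp only [fibre, Set.mem_ofPred_eq, conjLin_apply, charCoeffs_units_conj]

variable {F : Type*} [Field F] [ValuativeRel F] [TopologicalSpace F]
  [IsNonarchimedeanLocalField F] {n : ℕ}

/-- Conjugation by a unit, as a homeomorphism of the space of matrices. -/
def conjHomeomorph (g : (Matrix (Fin n) (Fin n) F)ˣ) :
    Matrix (Fin n) (Fin n) F ≃ₜ Matrix (Fin n) (Fin n) F where
  toEquiv := (conjLin g).toEquiv
  continuous_toFun := by
    change Continuous fun X => g.1 * X * g⁻¹.1
    fun_prop
  continuous_invFun := by
    change Continuous fun X => g⁻¹.1 * X * g.1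
    fun_prop

theorem IsChart.conj (g : (Matrix (Fin n) (Fin n) F)ˣ) {a : Fin n → F}
    {p : Matrix (Fin n) (Fin n) F →ₗ[F] (OffDiag n → F)} {U : Set (Matrix (Fin n) (Fin n) F)}
    (h : IsChart a p U) :
    IsChart a (p ∘ₗ (conjLin g).symm.toLinearMap) (conjLin g '' U) where
  isOpen := by
    obtain ⟨W, hW, rfl⟩ := h.isOpen
    refine ⟨conjLin g '' W, (conjHomeomorph g).isOpenMap W hW, ?_⟩
    rw [Set.image_inter (conjLin g).injective]
    congr 1
    ext X
    obtain ⟨X, rfl⟩ := (conjLin g).surjective X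
    rw [(conjLin g).injective.mem_set_image, conjLin_mem_fibre]
  injOn := by
    rintro _ ⟨X, hX, rfl⟩ _ ⟨Y, hY, rfl⟩ hXY
    rw [h.injOn hX hY (by simpa using hXY)]
  jacobian_ne_zero := by
    rintro _ ⟨X, hX, rfl⟩
    rw [jacobian_conjLin]
    exact h.jacobian_ne_zero X hX

variable [MeasurableSpace F] [BorelSpace F]

theorem map_conj_chartMeasure (g : (Matrix (Fin n) (Fin n) F)ˣ)
    (p : Matrix (Fin n) (Fin n) F →ₗ[F] (OffDiag n → F)) (U : Set (Matrix (Fin n) (Fin n) F)) :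
    (chartMeasure p U).map (conjHomeomorph g).toMeasurableEquiv =
      chartMeasure (p ∘ₗ (conjLin g).symm.toLinearMap) (conjLin g '' U) := by
  let c := (conjHomeomorph g).toMeasurableEquiv
  have hc : ∀ X, c X = conjLin g X := fun _ => rfl
  let e : U ≃ᵐ (conjLin g '' U : Set _) :=
    { toEquiv := (conjLin g).toEquiv.image U
      measurable_toFun := (c.measurable.comp measurable_subtype_coe).subtype_mk
      measurable_invFun := (c.symm.measurable.comp measurable_subtype_coe).subtype_mk }
  unfold chartMeasure
  have hdens : (fun X => (normAbs (jacobian p X) : ℝ≥0∞)⁻¹) =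
      (fun X => (normAbs (jacobian (p ∘ₗ (conjLin g).symm.toLinearMap) X) : ℝ≥0∞)⁻¹) ∘ c := by
    ext X
    simp only [Function.comp_apply, hc, jacobian_conjLin]
  have hp : (fun X : U => p X.1) =
      (fun X : (conjLin g '' U : Set _) => (p ∘ₗ (conjLin g).symm.toLinearMap) X.1) ∘ e := by
    ext X : 1
    change p X.1 = p ((conjLin g).symm (conjLin g X.1))
    simp
  rw [hdens, MeasurableEquiv.map_withDensity_comp, Measure.map_map c.measurable
    measurable_subtype_coe]
  congr 1
  rw [hp, ← MeasurableEquiv.comap_comp_measurableEquiv e _ _,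
    Measure.map_map measurable_subtype_coe e.measurable]
  rfl

/-- The form `ω` is invariant under conjugation, hence so is its measure. -/
theorem formMeasure_conj_image (g : (Matrix (Fin n) (Fin n) F)ˣ) (a : Fin n → F)
    (S : Set (Matrix (Fin n) (Fin n) F)) :
    formMeasure a (conjLin g '' S) = formMeasure a S := by
  have key : ∀ (g : (Matrix (Fin n) (Fin n) F)ˣ) (S : Set (Matrix (Fin n) (Fin n) F)),
      formMeasure a S ≤ formMeasure a (conjLin g '' S) := by
    intro g S
    let c := (conjHomeomorph g).toMeasurableEquiv
    have hle : formMeasure a ≤ (formMeasure a).map c.symm := by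
      refine iSup_le fun p => iSup_le fun U => iSup_le fun hU => ?_
      have h1 : chartMeasure (p ∘ₗ (conjLin g).symm.toLinearMap) (conjLin g '' U) ≤
          formMeasure a := le_iSup_of_le _ (le_iSup_of_le _ (le_iSup_of_le (hU.conj g) le_rfl))
      rw [← map_conj_chartMeasure] at h1
      have h2 := Measure.map_mono h1 c.symm.measurable
      rwa [Measure.map_map c.symm.measurable c.measurable, c.symm_comp_self,
        Measure.map_id] at h2
    calc formMeasure a S ≤ (formMeasure a).map c.symm S := hle S
      _ = formMeasure a (conjLin g '' S) := by
        rw [c.symm.map_apply]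
        congr 1
        exact (c.toEquiv.image_eq_preimage_symm S).symm
  refine le_antisymm ?_ (key g S)
  have := key g⁻¹ (conjLin g '' S)
  rwa [← conjLin_symm, Set.image_image, Set.image_congr fun X _ => (conjLin g).symm_apply_apply X,
    Set.image_id'] at this

end Measure

/-! ### Multisets of elementary divisors -/

section Multisets

/-- Two finite families with the same multiset of values differ by a bijection of the indices. -/
theorem exists_equiv_of_map_univ_eq {α β γ : Type*} [Fintype α] [Fintype β] {f : α → γ} {g : β → γ}
    (h : Finset.univ.val.map f = Finset.univ.val.map g) : ∃ σ : α ≃ β, ∀ a, g (σ a) = f a := by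
  classical
  have hcard : ∀ c, Nonempty ({a // f a = c} ≃ {b // g b = c}) := by
    intro c
    refine ⟨Fintype.equivOfCardEq ?_⟩
    have := congrArg (Multiset.count c) h
    rw [Multiset.count_map, Multiset.count_map] at this
    rw [Fintype.card_subtype, Fintype.card_subtype]
    simpa [Finset.card, eq_comm] using this
  let τ := fun c => (hcard c).some
  refine ⟨(Equiv.sigmaFiberEquiv f).symm.trans
    ((Equiv.sigmaCongrRight τ).trans (Equiv.sigmaFiberEquiv g)), fun a => ?_⟩
  exact (τ (f a) ⟨a, rfl⟩).2

/-- The parts of a partition, given with multiplicity, are determined by the sums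
`∑ᵢ max (kᵢ - j, 0)`: the second difference of these sums at `j` counts the parts `j + 1`. -/
theorem multiset_eq_of_sum_map_sub_eq {k k' : Multiset ℕ} (hk : ∀ i ∈ k, 1 ≤ i)
    (hk' : ∀ i ∈ k', 1 ≤ i)
    (h : ∀ j, (k.map fun a => a - j).sum = (k'.map fun a => a - j).sum) : k = k' := by
  have key : ∀ (k : Multiset ℕ) (j : ℕ), k.count (j + 1) + 2 * (k.map fun a => a - (j + 1)).sum =
      (k.map fun a => a - j).sum + (k.map fun a => a - (j + 2)).sum := by
    intro k j
    induction k using Multiset.induction_on with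
    | empty => simp
    | cons a s ih =>
      simp only [Multiset.count_cons, Multiset.map_cons, Multiset.sum_cons]
      split_ifs with hj <;> omega
  ext a
  rcases a with _ | j
  · rw [Multiset.count_eq_zero.2 fun h0 => absurd (hk 0 h0) (by simp),
      Multiset.count_eq_zero.2 fun h0 => absurd (hk' 0 h0) (by simp)]
  · have h1 := key k j
    have h2 := key k' j
    rw [h, h, h] at h1
    omega

/-- The multiset of the positive values of `e`. -/
def posParts {n : ℕ} (e : Fin n → ℕ) : Multiset ℕ := (Finset.univ.val.map e).filter (0 < ·)

theorem one_le_of_mem_posParts {n : ℕ} {e : Fin n → ℕ} {i : ℕ} (hi : i ∈ posParts e) : 1 ≤ i :=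
  (Multiset.mem_filter.1 hi).2

theorem sum_posParts {n : ℕ} (e : Fin n → ℕ) : (posParts e).sum = ∑ i, e i := by
  have h := Multiset.filter_add_not (0 < ·) (Finset.univ.val.map e)
  have h0 : ((Finset.univ.val.map e).filter fun a => ¬ 0 < a).sum = 0 :=
    Multiset.sum_eq_zero fun x hx => by simpa using (Multiset.mem_filter.1 hx).2
  have := congrArg Multiset.sum h
  rw [Multiset.sum_add, h0, add_zero] at this
  exact this

theorem posParts_eq_map {n : ℕ} (e : Fin n → ℕ) :
    posParts e = (Finset.univ : Finset {i // 0 < e i}).val.map fun i => e i.1 := by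
  rw [posParts, Multiset.filter_map]
  have : (Finset.univ : Finset {i // 0 < e i}).val.map Subtype.val =
      Finset.univ.val.filter ((0 < ·) ∘ e) := by
    have := Finset.subtype_map (s := (Finset.univ : Finset (Fin n))) (fun i => 0 < e i)
    rw [Finset.subtype_univ] at this
    exact congrArg Finset.val this
  rw [← this, Multiset.map_map]
  rfl

theorem card_posParts {n : ℕ} (e : Fin n → ℕ) :
    Multiset.card (posParts e) = Fintype.card {i // 0 < e i} := by
  rw [posParts_eq_map, Multiset.card_map]
  rfl

theorem card_posParts_le {n : ℕ} (e : Fin n → ℕ) : Multiset.card (posParts e) ≤ n := by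
  rw [card_posParts]
  exact (Fintype.card_subtype_le _).trans (by simp)

theorem map_univ_eq_posParts_add {n : ℕ} (e : Fin n → ℕ) :
    Finset.univ.val.map e =
      posParts e + Multiset.replicate (n - Multiset.card (posParts e)) 0 := by
  have h := Multiset.filter_add_not (0 < ·) (Finset.univ.val.map e)
  have h0 : (Finset.univ.val.map e).filter (fun a => ¬ 0 < a) =
      Multiset.replicate (n - Multiset.card (posParts e)) 0 := by
    refine Multiset.eq_replicate.2 ⟨?_, fun b hb => by simpa using (Multiset.mem_filter.1 hb).2⟩
    have := congrArg Multiset.card h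
    rw [Multiset.card_add, Multiset.card_map] at this
    simp only [posParts, Finset.card_val, Finset.card_univ, Fintype.card_fin] at this ⊢
    omega
  rw [← h0]
  exact h.symm

theorem exists_posParts_eq {n : ℕ} {k : Multiset ℕ} (hk : ∀ i ∈ k, 1 ≤ i)
    (hn : Multiset.card k ≤ n) : ∃ e : Fin n → ℕ, posParts e = k := by
  let l : Multiset ℕ := k + Multiset.replicate (n - Multiset.card k) 0
  have hl : Multiset.card l = n := by simp [l]; omega
  obtain ⟨v, hv⟩ : ∃ v : Fin n → ℕ, Finset.univ.val.map v = l := by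
    obtain ⟨l', hl'⟩ := Quotient.exists_rep l
    change (l' : Multiset ℕ) = l at hl'
    rw [← hl', Multiset.coe_card] at hl
    subst hl
    exact ⟨l'.get, by rw [← hl', Fin.univ_val_map, List.ofFn_get]⟩
  refine ⟨v, ?_⟩
  rw [posParts, hv, Multiset.filter_add, Multiset.filter_eq_self (p := (0 < ·)).2 hk,
    Multiset.filter_eq_nil.2 fun a ha => by simp [Multiset.eq_of_mem_replicate ha]]
  exact add_zero k

end Multisets

section UnitsLin

variable {R : Type*} [CommRing R] {n : ℕ}

/-- An invertible matrix, as an automorphism of `Rⁿ`. -/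
def unitsLin (u : (Matrix (Fin n) (Fin n) R)ˣ) : (Fin n → R) ≃ₗ[R] (Fin n → R) :=
  LinearEquiv.ofLinearMap u.1.mulVecLin u⁻¹.1.mulVecLin
    (by rw [← Matrix.mulVecLin_mul, u.mul_inv, Matrix.mulVecLin_one])
    (by rw [← Matrix.mulVecLin_mul, u.inv_mul, Matrix.mulVecLin_one])

theorem unitsLin_apply (u : (Matrix (Fin n) (Fin n) R)ˣ) (x : Fin n → R) :
    unitsLin u x = u.1.mulVec x := rfl

theorem coe_unitsLin (u : (Matrix (Fin n) (Fin n) R)ˣ) :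
    (unitsLin u : (Fin n → R) →ₗ[R] (Fin n → R)) = u.1.mulVecLin := rfl

theorem exists_unitsLin_eq (g : (Fin n → R) ≃ₗ[R] (Fin n → R)) :
    ∃ u : (Matrix (Fin n) (Fin n) R)ˣ, unitsLin u = g := by
  refine ⟨⟨LinearMap.toMatrix' g, LinearMap.toMatrix' g.symm, ?_, ?_⟩, ?_⟩
  · rw [← LinearMap.toMatrix'_comp]; simp
  · rw [← LinearMap.toMatrix'_comp]; simp
  · ext1 x
    rw [unitsLin_apply]
    exact LinearMap.congr_fun (Matrix.toLin'_toMatrix' (g : (Fin n → R) →ₗ[R] (Fin n → R))) x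

end UnitsLin

/-! ### Sublattices and their types -/

section Types

open IsLocalRing

theorem HasType.map_linearEquiv {R : Type*} [CommRing R] [IsLocalRing R] {n : ℕ}
    {M : Submodule R (Fin n → R)} {k : Multiset ℕ} (h : HasType M k)
    (g : (Fin n → R) ≃ₗ[R] (Fin n → R)) :
    HasType (M.map (g : (Fin n → R) →ₗ[R] (Fin n → R))) k := by
  obtain ⟨h1, ⟨f⟩⟩ := h
  exact ⟨h1, ⟨(Submodule.Quotient.equiv M _ g rfl).symm.trans f⟩⟩

/-- The sublattice `⊕ᵢ 𝔪^{eᵢ}` of `Rⁿ`. -/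
def diagLattice (R : Type*) [CommRing R] [IsLocalRing R] {n : ℕ} (e : Fin n → ℕ) :
    Submodule R (Fin n → R) :=
  Submodule.pi Set.univ fun i => maximalIdeal R ^ e i

theorem mem_diagLattice {R : Type*} [CommRing R] [IsLocalRing R] {n : ℕ} {e : Fin n → ℕ}
    {x : Fin n → R} : x ∈ diagLattice R e ↔ ∀ i, x i ∈ maximalIdeal R ^ e i := by
  simp [diagLattice, Submodule.mem_pi]

theorem hasType_diagLattice (R : Type*) [CommRing R] [IsLocalRing R] {n : ℕ} (e : Fin n → ℕ) :
    HasType (diagLattice R e) (posParts e) := by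
  refine ⟨fun i => one_le_of_mem_posParts, ?_⟩
  have hsub : ∀ i, ¬ 0 < e i → Subsingleton (R ⧸ maximalIdeal R ^ e i) := by
    intro i hi
    rw [Ideal.Quotient.subsingleton_iff, Nat.eq_zero_of_not_pos hi, pow_zero, Ideal.one_eq_top]
  -- the factors with `eᵢ = 0` are trivial
  let r : (∀ i, R ⧸ maximalIdeal R ^ e i) →ₗ[R] ∀ i : {i // 0 < e i}, R ⧸ maximalIdeal R ^ e i.1 :=
    LinearMap.pi fun i => LinearMap.proj i.1
  have hr : Function.Bijective r := by
    constructor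
    · intro x y hxy
      ext i
      by_cases hi : 0 < e i
      · exact congrFun hxy ⟨i, hi⟩
      · exact (hsub i hi).elim _ _
    · intro y
      refine ⟨fun i => if hi : 0 < e i then y ⟨i, hi⟩ else 0, ?_⟩
      ext i
      simp [r, i.2]
  obtain ⟨σ, hσ⟩ := exists_equiv_of_map_univ_eq (f := fun i : {i // 0 < e i} => e i.1)
    (g := fun i : (posParts e).ToType => (i.1 : ℕ)) (by
      rw [← posParts_eq_map]; exact (Multiset.map_univ_coe _).symm)
  exact ⟨(Submodule.quotientPi _).trans ((LinearEquiv.ofBijective r hr).trans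
    ((LinearEquiv.piCongrRight fun i => Submodule.quotEquivOfEq _ _ (by rw [hσ])).trans
      (LinearEquiv.piCongrLeft R
        (fun i : (posParts e).ToType => R ⧸ maximalIdeal R ^ (i.1 : ℕ)) σ)))⟩

variable {R : Type*} [CommRing R] [IsDomain R] [IsDiscreteValuationRing R] {n : ℕ}

theorem natCard_quotient_maximalIdeal_pow (j : ℕ) :
    Nat.card (R ⧸ maximalIdeal R ^ j) = Nat.card (ResidueField R) ^ j := by
  have := cardQuot_pow_of_prime (P := maximalIdeal R) (IsDiscreteValuationRing.not_a_field R)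
    (i := j)
  rwa [Submodule.cardQuot_apply, Submodule.cardQuot_apply] at this

theorem pow_mul_mem_maximalIdeal_pow {ϖ : R} (hϖ : Irreducible ϖ) (j k : ℕ) (x : R) :
    ϖ ^ j * x ∈ maximalIdeal R ^ k ↔ x ∈ maximalIdeal R ^ (k - j) := by
  rw [hϖ.maximalIdeal_eq, Ideal.span_singleton_pow, Ideal.span_singleton_pow,
    Ideal.mem_span_singleton, Ideal.mem_span_singleton]
  rcases le_total j k with h | h
  · obtain ⟨i, rfl⟩ := Nat.exists_eq_add_of_le h
    rw [pow_add, mul_dvd_mul_iff_left (pow_ne_zero _ hϖ.ne_zero), Nat.add_sub_cancel_left]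
  · rw [Nat.sub_eq_zero_of_le h, pow_zero]
    exact iff_of_true ((pow_dvd_pow _ h).mul_right _) (one_dvd _)

theorem natCard_range_lsmul_quotient {ϖ : R} (hϖ : Irreducible ϖ) (j k : ℕ) :
    Nat.card (LinearMap.range (LinearMap.lsmul R (R ⧸ maximalIdeal R ^ k) (ϖ ^ j))) =
      Nat.card (ResidueField R) ^ (k - j) := by
  rw [← natCard_quotient_maximalIdeal_pow]
  let φ : R →ₗ[R] R ⧸ maximalIdeal R ^ k :=
    LinearMap.lsmul R (R ⧸ maximalIdeal R ^ k) (ϖ ^ j) ∘ₗ (maximalIdeal R ^ k).mkQ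
  have hr : LinearMap.range φ =
      LinearMap.range (LinearMap.lsmul R (R ⧸ maximalIdeal R ^ k) (ϖ ^ j)) :=
    LinearMap.range_comp_of_range_eq_top _ (Submodule.range_mkQ _)
  have hk : LinearMap.ker φ = maximalIdeal R ^ (k - j) := by
    ext x
    rw [← pow_mul_mem_maximalIdeal_pow hϖ, LinearMap.mem_ker, ← Submodule.Quotient.mk_eq_zero]
    rfl
  rw [← hr, ← hk]
  exact Nat.card_congr φ.quotKerEquivRange.symm.toEquiv

theorem natCard_range_lsmul_of_hasType {ϖ : R} (hϖ : Irreducible ϖ) (j : ℕ)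
    {M : Submodule R (Fin n → R)} {k : Multiset ℕ} (h : HasType M k) :
    Nat.card (LinearMap.range (LinearMap.lsmul R ((Fin n → R) ⧸ M) (ϖ ^ j))) =
      Nat.card (ResidueField R) ^ (k.map fun a => a - j).sum := by
  obtain ⟨-, ⟨f⟩⟩ := h
  let Q : k.ToType → Type _ := fun i => R ⧸ maximalIdeal R ^ (i.1 : ℕ)
  have e1 : LinearMap.range (LinearMap.lsmul R ((Fin n → R) ⧸ M) (ϖ ^ j)) ≃
      {x : ∀ i, Q i // ∀ i, x i ∈ LinearMap.range (LinearMap.lsmul R (Q i) (ϖ ^ j))} := by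
    refine f.toEquiv.subtypeEquiv fun x => ?_
    constructor
    · rintro ⟨y, rfl⟩ i
      exact ⟨f y i, by simp⟩
    · intro hx
      choose y hy using hx
      refine ⟨f.symm y, f.injective ?_⟩
      ext i
      rw [← LinearEquiv.coe_toEquiv, ← hy]
      simp
  rw [Nat.card_congr (e1.trans (Equiv.subtypePiEquivPi)), Nat.card_pi,
    Finset.prod_congr rfl fun i _ => natCard_range_lsmul_quotient hϖ j i.1,
    Finset.prod_pow_eq_pow_sum]
  congr 1
  conv_rhs => rw [← Multiset.map_univ_coe k, Multiset.map_map]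
  rfl

variable [Finite (ResidueField R)]

theorem one_lt_natCard_residueField : 1 < Nat.card (ResidueField R) := Finite.one_lt_card

theorem HasType.unique {M : Submodule R (Fin n → R)} {k k' : Multiset ℕ} (h : HasType M k)
    (h' : HasType M k') : k = k' := by
  obtain ⟨ϖ, hϖ⟩ := IsDiscreteValuationRing.exists_irreducible R
  refine multiset_eq_of_sum_map_sub_eq h.1 h'.1 fun j => ?_
  exact Nat.pow_right_injective (one_lt_natCard_residueField (R := R))
    ((natCard_range_lsmul_of_hasType hϖ j h).symm.trans (natCard_range_lsmul_of_hasType hϖ j h'))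

omit [Finite (ResidueField R)] in
theorem HasType.pow_sum_smul_mem {ϖ : R} (hϖ : Irreducible ϖ) {M : Submodule R (Fin n → R)}
    {k : Multiset ℕ} (h : HasType M k) (x : Fin n → R) : ϖ ^ k.sum • x ∈ M := by
  obtain ⟨-, ⟨f⟩⟩ := h
  rw [← Submodule.Quotient.mk_eq_zero, Submodule.Quotient.mk_smul, ← f.map_eq_zero_iff, map_smul]
  ext i
  obtain ⟨y, hy⟩ := Submodule.Quotient.mk_surjective _ (f (Submodule.Quotient.mk x) i)
  rw [Pi.smul_apply, ← hy, ← Submodule.Quotient.mk_smul, Pi.zero_apply,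
    Submodule.Quotient.mk_eq_zero, smul_eq_mul]
  refine Ideal.mul_mem_right _ _ ?_
  have hle : (i.1 : ℕ) ≤ k.sum := Multiset.le_sum_of_mem Multiset.coe_mem
  exact Ideal.pow_le_pow_right hle (Ideal.pow_mem_pow ((mem_maximalIdeal _).2 hϖ.not_isUnit) _)

omit [Finite (ResidueField R)] in
/-- Elementary divisors: a sublattice of full rank is the image of some `⊕ᵢ 𝔪^{eᵢ}` under
`GL_n(R)`. -/
theorem exists_eq_map_diagLattice {M : Submodule R (Fin n → R)} {a : R} (ha : a ≠ 0)
    (h : ∀ x, a • x ∈ M) : ∃ (u : (Matrix (Fin n) (Fin n) R)ˣ) (e : Fin n → ℕ),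
      M = (diagLattice R e).map (unitsLin u : (Fin n → R) →ₗ[R] (Fin n → R)) := by
  obtain ⟨ϖ, hϖ⟩ := IsDiscreteValuationRing.exists_irreducible R
  have hrank : Module.finrank R M = Module.finrank R (Fin n → R) := by
    refine le_antisymm (Submodule.finrank_le M) ?_
    refine LinearMap.finrank_le_finrank_of_injective
      (f := (LinearMap.lsmul R (Fin n → R) a).codRestrict M h) ?_
    intro x y hxy
    exact smul_right_injective _ ha (congrArg Subtype.val hxy)
  obtain ⟨b, c, b', hb⟩ := Submodule.exists_smith_normal_form_of_rank_eq (Pi.basisFun R (Fin n))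
    hrank
  have hc : ∀ i, ∃ e : ℕ, Associated (c i) (ϖ ^ e) := by
    intro i
    refine IsDiscreteValuationRing.associated_pow_irreducible (fun h0 => ?_) hϖ
    have := hb i
    rw [h0, zero_smul] at this
    exact b'.ne_zero i (Subtype.ext this)
  choose e he using hc
  have hmem : ∀ i (x : R), x ∈ maximalIdeal R ^ e i ↔ c i ∣ x := by
    intro i x
    rw [hϖ.maximalIdeal_eq, Ideal.span_singleton_pow, Ideal.mem_span_singleton,
      (he i).dvd_iff_dvd_left]
  obtain ⟨u, hu⟩ := exists_unitsLin_eq b.equivFun.symm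
  refine ⟨u, e, ?_⟩
  rw [hu]
  ext x
  rw [Submodule.mem_map_equiv, LinearEquiv.symm_symm, mem_diagLattice]
  simp only [hmem]
  constructor
  · intro hx i
    have h1 : x = ∑ i, b'.repr ⟨x, hx⟩ i • c i • b i := by
      have := congrArg Subtype.val (b'.sum_repr ⟨x, hx⟩)
      refine this.symm.trans ?_
      rw [Submodule.coe_sum]
      exact Finset.sum_congr rfl fun i _ => by rw [← hb]; rfl
    refine ⟨b'.repr ⟨x, hx⟩ i, ?_⟩
    conv_lhs => rw [h1]
    simp [Finsupp.single_apply, mul_comm]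
  · intro hx
    choose y hy using hx
    rw [← b.sum_equivFun x]
    refine Submodule.sum_mem _ fun i _ => ?_
    rw [hy, mul_comm, mul_smul, ← hb]
    exact M.smul_mem _ (b' i).2

theorem hasType_iff {M : Submodule R (Fin n → R)} {k : Multiset ℕ} :
    HasType M k ↔ ∃ (u : (Matrix (Fin n) (Fin n) R)ˣ) (e : Fin n → ℕ),
      M = (diagLattice R e).map (unitsLin u : (Fin n → R) →ₗ[R] (Fin n → R)) ∧ posParts e = k := by
  constructor
  · intro h
    obtain ⟨ϖ, hϖ⟩ := IsDiscreteValuationRing.exists_irreducible R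
    obtain ⟨u, e, rfl⟩ := exists_eq_map_diagLattice (pow_ne_zero _ hϖ.ne_zero)
      (h.pow_sum_smul_mem hϖ)
    exact ⟨u, e, rfl, ((hasType_diagLattice R e).map_linearEquiv _).unique h⟩
  · rintro ⟨u, e, rfl, rfl⟩
    exact (hasType_diagLattice R e).map_linearEquiv _

/-- `GL_n(R)` acts transitively on the sublattices of a given type. -/
theorem HasType.exists_units_map_eq {M M' : Submodule R (Fin n → R)} {k : Multiset ℕ}
    (h : HasType M k) (h' : HasType M' k) : ∃ u : (Matrix (Fin n) (Fin n) R)ˣ,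
      M.map (unitsLin u : (Fin n → R) →ₗ[R] (Fin n → R)) = M' := by
  obtain ⟨u, e, rfl, he⟩ := hasType_iff.1 h
  obtain ⟨u', e', rfl, he'⟩ := hasType_iff.1 h'
  obtain ⟨σ, hσ⟩ := exists_equiv_of_map_univ_eq (f := e) (g := e') (by
    rw [map_univ_eq_posParts_add, map_univ_eq_posParts_add, he, he'])
  have hdiag : (diagLattice R e).map
      (LinearEquiv.funCongrLeft R R σ.symm : (Fin n → R) →ₗ[R] (Fin n → R)) =
        diagLattice R e' := by
    ext x
    rw [Submodule.mem_map_equiv, mem_diagLattice, mem_diagLattice]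
    simp only [LinearEquiv.funCongrLeft_symm, LinearEquiv.funCongrLeft_apply,
      LinearMap.funLeft_apply, Equiv.symm_symm, ← hσ]
    exact σ.forall_congr_left.trans (by simp)
  obtain ⟨w, hw⟩ := exists_unitsLin_eq
    (((unitsLin u).symm.trans (LinearEquiv.funCongrLeft R R σ.symm)).trans (unitsLin u'))
  refine ⟨w, ?_⟩
  rw [hw, LinearEquiv.coe_trans, LinearEquiv.coe_trans, Submodule.map_comp, Submodule.map_comp]
  have : ((diagLattice R e).map (unitsLin u : (Fin n → R) →ₗ[R] (Fin n → R))).map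
      ((unitsLin u).symm : (Fin n → R) →ₗ[R] (Fin n → R)) = diagLattice R e := by
    rw [← Submodule.map_comp, LinearEquiv.symm_comp, Submodule.map_id]
  rw [this, hdiag]

theorem HasType.card_le {M : Submodule R (Fin n → R)} {k : Multiset ℕ} (h : HasType M k) :
    Multiset.card k ≤ n := by
  obtain ⟨u, e, -, rfl⟩ := hasType_iff.1 h
  exact card_posParts_le e

omit [Finite (ResidueField R)] in
theorem exists_hasType {k : Multiset ℕ} (hk : ∀ i ∈ k, 1 ≤ i) (hn : Multiset.card k ≤ n) :
    ∃ M : Submodule R (Fin n → R), HasType M k := by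
  obtain ⟨e, rfl⟩ := exists_posParts_eq hk hn
  exact ⟨_, hasType_diagLattice R e⟩

omit [Finite (ResidueField R)] in
theorem HasType.hasType_typeRep {M : Submodule R (Fin n → R)} {k : Multiset ℕ} (h : HasType M k) :
    HasType (typeRep R n k) k := 
  Classical.epsilon_spec (p := fun M : Submodule R (Fin n → R) => HasType M k) ⟨M, h⟩

end Types

/-! ### Reduction modulo the maximal ideal -/

section Reduction

open IsLocalRing

variable {R : Type*} [CommRing R] [IsLocalRing R] {n : ℕ}

theorem reduceVec_surjective : Function.Surjective (reduceVec R n) := by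
  intro v
  choose w hw using fun i => residue_surjective (v i)
  exact ⟨w, funext hw⟩

theorem reduceVec_eq_zero {x : Fin n → R} : reduceVec R n x = 0 ↔ ∀ i, x i ∈ maximalIdeal R := by
  simp [reduceVec, funext_iff]

theorem reduceVec_mulVec (A : Matrix (Fin n) (Fin n) R) (x : Fin n → R) :
    reduceVec R n (A.mulVec x) = (A.map (residue R)).mulVec (reduceVec R n x) := by
  ext i
  exact RingHom.map_mulVec (residue R) A x i

theorem mem_reduceLattice {M : Submodule R (Fin n → R)} {v : Fin n → ResidueField R} :
    v ∈ reduceLattice M ↔ ∃ x ∈ M, reduceVec R n x = v := Iff.rfl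

/-- The reduction of an invertible matrix. -/
noncomputable def reduceUnit (u : (Matrix (Fin n) (Fin n) R)ˣ) :
    (Matrix (Fin n) (Fin n) (ResidueField R))ˣ :=
  Units.map (residue R).mapMatrix.toMonoidHom u

theorem coe_reduceUnit (u : (Matrix (Fin n) (Fin n) R)ˣ) :
    (reduceUnit u).1 = u.1.map (residue R) := rfl

theorem reduceLattice_map_mulVecLin (M : Submodule R (Fin n → R)) (A : Matrix (Fin n) (Fin n) R) :
    reduceLattice (M.map A.mulVecLin) =
      (reduceLattice M).map (A.map (residue R)).mulVecLin := by
  ext v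
  simp only [mem_reduceLattice, Submodule.mem_map, exists_exists_and_eq_and, Matrix.mulVecLin_apply,
    reduceVec_mulVec]

theorem reduceLattice_range (A : Matrix (Fin n) (Fin n) R) :
    reduceLattice (LinearMap.range A.mulVecLin) =
      LinearMap.range (A.map (residue R)).mulVecLin := by
  rw [LinearMap.range_eq_map, reduceLattice_map_mulVecLin, LinearMap.range_eq_map]
  congr 1
  rw [eq_top_iff]
  intro v _
  obtain ⟨x, rfl⟩ := reduceVec_surjective v
  exact ⟨x, trivial, rfl⟩

theorem finrank_reduceLattice_diagLattice (e : Fin n → ℕ) :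
    Module.finrank (ResidueField R) (reduceLattice (diagLattice R e)) +
      Multiset.card (posParts e) = n := by
  let r : (Fin n → ResidueField R) →ₗ[ResidueField R] ({i // 0 < e i} → ResidueField R) :=
    LinearMap.funLeft _ _ Subtype.val
  have hr : Function.Surjective r := LinearMap.funLeft_surjective_of_injective _ _ _
    Subtype.val_injective
  have hk : reduceLattice (diagLattice R e) = LinearMap.ker r := by
    ext v
    rw [mem_reduceLattice, LinearMap.mem_ker]
    constructor
    · rintro ⟨x, hx, rfl⟩
      ext i
      rw [mem_diagLattice] at hx
      exact (residue_eq_zero_iff _).2 (Ideal.pow_le_self i.2.ne' (hx i.1))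
    · intro hv
      obtain ⟨x, rfl⟩ := reduceVec_surjective v
      refine ⟨fun i => if 0 < e i then 0 else x i, mem_diagLattice.2 fun i => ?_, ?_⟩
      · by_cases hi : 0 < e i
        · simp [hi]
        · simp [Nat.eq_zero_of_not_pos hi]
      · ext i
        by_cases hi : 0 < e i
        · have : residue R (x i) = 0 := congrFun hv ⟨i, hi⟩
          simp [reduceVec, hi, this]
        · simp [reduceVec, hi]
  have := r.finrank_range_add_finrank_ker
  rw [LinearMap.range_eq_top.2 hr, finrank_top, Module.finrank_fintype_fun_eq_card,
    Module.finrank_fintype_fun_eq_card, Fintype.card_fin, ← hk, ← card_posParts] at this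
  omega

theorem HasType.finrank_reduceLattice_add_card {R : Type*} [CommRing R] [IsDomain R]
    [IsDiscreteValuationRing R] [Finite (ResidueField R)] {M : Submodule R (Fin n → R)}
    {k : Multiset ℕ} (h : HasType M k) :
    Module.finrank (ResidueField R) (reduceLattice M) + Multiset.card k = n := by
  obtain ⟨u, e, rfl, rfl⟩ := hasType_iff.1 h
  rw [coe_unitsLin, reduceLattice_map_mulVecLin, ← coe_reduceUnit, ← coe_unitsLin,
    LinearEquiv.finrank_map_eq]
  exact finrank_reduceLattice_diagLattice e

/-- The stabiliser of `M` in `GL_n(R)` acts transitively on the subspaces of `M̄` of a given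
dimension. An automorphism `h` of `κⁿ` with `h - 1` valued in `M̄` lifts to `1 + N` with `N` valued
in `M`, and such a lift preserves `M`. -/
theorem exists_units_map_eq_of_finrank_eq {M : Submodule R (Fin n → R)}
    {V V' : Submodule (ResidueField R) (Fin n → ResidueField R)} (hV : V ≤ reduceLattice M)
    (hV' : V' ≤ reduceLattice M)
    (hd : Module.finrank (ResidueField R) V = Module.finrank (ResidueField R) V') :
    ∃ u : (Matrix (Fin n) (Fin n) R)ˣ,
      M.map (unitsLin u : (Fin n → R) →ₗ[R] (Fin n → R)) = M ∧
      V.map (unitsLin (reduceUnit u) :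
        (Fin n → ResidueField R) →ₗ[ResidueField R] (Fin n → ResidueField R)) = V' := by
  let κ := ResidueField R
  let K := reduceLattice M
  -- an automorphism `h` of `κⁿ` preserving `M̄` with `h V = V'` and `h = 1` on a complement of `M̄`
  obtain ⟨h, hhV, hh1⟩ : ∃ h : (Fin n → κ) ≃ₗ[κ] (Fin n → κ),
      V.map (h : (Fin n → κ) →ₗ[κ] (Fin n → κ)) = V' ∧ ∀ x, h x - x ∈ K := by
    let VK := V.comap K.subtype
    let VK' := V'.comap K.subtype
    have e0 : VK ≃ₗ[κ] VK' :=
      (Submodule.comapSubtypeEquivOfLe hV).trans ((LinearEquiv.ofFinrankEq V V' hd).trans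
        (Submodule.comapSubtypeEquivOfLe hV').symm)
    obtain ⟨f, hf⟩ := Submodule.exists_linearEquiv_restrict_eq e0
    obtain ⟨C, hC⟩ := Submodule.exists_isCompl K
    let P := K.prodEquivOfIsCompl C hC
    let h := P.symm.trans ((f.prodCongr (LinearEquiv.refl κ C)).trans P)
    have hP : ∀ (x : K) (y : C), h (x + y) = f x + y := by
      intro x y
      have : (x + y : Fin n → κ) = P (x, y) := by simp [P]
      rw [this]
      simp [h, P]
    refine ⟨h, ?_, ?_⟩
    · have hle : V.map (h : (Fin n → κ) →ₗ[κ] (Fin n → κ)) ≤ V' := by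
        rintro _ ⟨x, hx, rfl⟩
        have h1 := hP ⟨x, hV hx⟩ 0
        have h2 := hf ⟨⟨x, hV hx⟩, hx⟩
        simp only [ZeroMemClass.coe_zero, add_zero] at h1
        rw [LinearEquiv.coe_coe, h1, ← h2]
        exact (e0 ⟨⟨x, hV hx⟩, hx⟩).2
      refine Submodule.eq_of_le_of_finrank_eq hle ?_
      rw [LinearEquiv.finrank_map_eq, hd]
    · intro x
      obtain ⟨⟨y, z⟩, rfl⟩ := P.surjective x
      have : P (y, z) = (y + z : Fin n → κ) := by simp [P]
      rw [this, hP, add_sub_add_right_eq_sub]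
      exact K.sub_mem (f y).2 y.2
  have hlift : ∀ i : Fin n, ∃ x ∈ M, reduceVec R n x = h (Pi.single i 1) - Pi.single i 1 :=
    fun i => mem_reduceLattice.1 (hh1 _)
  choose w hwM hw using hlift
  let N : Matrix (Fin n) (Fin n) R := Matrix.of fun i j => w j i
  have hN : ∀ x, N.mulVec x ∈ M := by
    intro x
    have : N.mulVec x = ∑ j, x j • w j := by
      ext i
      simp [N, Matrix.mulVec, dotProduct, mul_comm]
    rw [this]
    exact M.sum_mem fun j _ => M.smul_mem _ (hwM j)
  have hred : ∀ x, ((1 + N).map (residue R)).mulVec x = h x := by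
    have : ((1 + N).map (residue R)).mulVecLin = (h : (Fin n → κ) →ₗ[κ] (Fin n → κ)) := by
      refine LinearMap.pi_ext' fun j => LinearMap.ext_ring ?_
      ext i
      have := congrFun (hw j) i
      simp only [reduceVec, LinearMap.coe_mk, AddHom.coe_mk, Pi.sub_apply] at this
      simp only [LinearMap.comp_apply, LinearMap.single_apply, Matrix.mulVecLin_apply,
        Matrix.mulVec_single_one, Matrix.col_apply, Matrix.map_apply, Matrix.add_apply, map_add, N,
        Matrix.of_apply, this, LinearEquiv.coe_coe, Matrix.one_apply, Pi.single_apply]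
      split_ifs <;> simp
    intro x
    exact LinearMap.congr_fun this x
  have hdet : IsUnit (1 + N).det := by
    rw [← isUnit_map_iff (residue R), RingHom.map_det]
    obtain ⟨v, hv⟩ := exists_unitsLin_eq h
    have : (residue R).mapMatrix (1 + N) = v.1 := by
      refine Matrix.mulVec_injective ?_
      ext1 x
      exact (hred x).trans (by rw [← hv]; rfl)
    rw [this]
    exact (Matrix.isUnit_iff_isUnit_det _).1 v.isUnit
  obtain ⟨u, hu⟩ := (Matrix.isUnit_iff_isUnit_det _).2 hdet
  have happ : ∀ x, unitsLin u x = x + N.mulVec x := by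
    intro x
    rw [unitsLin_apply, hu, Matrix.add_mulVec, Matrix.one_mulVec]
  refine ⟨u, ?_, ?_⟩
  · ext x
    obtain ⟨y, rfl⟩ := (unitsLin u).surjective x
    rw [Submodule.mem_map_equiv, LinearEquiv.symm_apply_apply, happ]
    exact (Submodule.add_mem_iff_left _ (hN y)).symm
  · rw [← hhV]
    congr 1
    refine LinearMap.ext fun x => ?_
    exact (congrArg (fun A : Matrix _ _ R => (A.map (residue R)).mulVec x) hu).trans (hred x)

end Reduction

/-! ### Counting subspaces over a finite field -/

section Subspaces

variable {κ V V' : Type*} [Field κ] [AddCommGroup V] [Module κ V]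
  [AddCommGroup V'] [Module κ V']

theorem natCard_finrank_eq_grCard [FiniteDimensional κ V] (a : ℕ) :
    Nat.card {W : Submodule κ V // Module.finrank κ W = a} = grCard κ a (Module.finrank κ V) := by
  let e : V ≃ₗ[κ] (Fin (Module.finrank κ V) → κ) := LinearEquiv.ofFinrankEq _ _ (by simp)
  refine Nat.card_congr ((Submodule.orderIsoMapComap e).toEquiv.subtypeEquiv fun W => ?_)
  change _ ↔ Module.finrank κ (W.map (e : V →ₗ[κ] (Fin (Module.finrank κ V) → κ))) = a
  rw [LinearEquiv.finrank_map_eq]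

theorem natCard_le_finrank_eq_grCard [FiniteDimensional κ V] (K : Submodule κ V) (a : ℕ) :
    Nat.card {W : Submodule κ V // W ≤ K ∧ Module.finrank κ W = a} =
      grCard κ a (Module.finrank κ K) := by
  rw [← natCard_finrank_eq_grCard]
  refine Nat.card_congr ⟨fun W => ⟨W.1.comap K.subtype, ?_⟩, fun W => ⟨W.1.map K.subtype, ?_, ?_⟩,
    fun W => ?_, fun W => ?_⟩
  · rw [(Submodule.comapSubtypeEquivOfLe W.2.1).finrank_eq, W.2.2]
  · exact Submodule.map_subtype_le K W.1
  · rw [Submodule.finrank_map_subtype_eq, W.2]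
  · exact Subtype.ext (by simpa using W.2.1)
  · exact Subtype.ext (Submodule.comap_map_eq_of_injective K.subtype_injective _)

/-- Passing to annihilators exchanges dimension and codimension. -/
theorem grCard_sub {a b : ℕ} (h : a ≤ b) : grCard κ (b - a) b = grCard κ a b := by
  have hd : Module.finrank κ (Module.Dual κ (Fin b → κ)) = b := by
    rw [Subspace.dual_finrank_eq, Module.finrank_fin_fun]
  have h1 := natCard_finrank_eq_grCard (κ := κ) (V := Module.Dual κ (Fin b → κ)) a
  rw [hd] at h1
  rw [← h1, grCard]
  refine Nat.card_congr ((Subspace.orderIsoFiniteDimensional (K := κ)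
    (V := Fin b → κ)).toEquiv.trans OrderDual.ofDual |>.subtypeEquiv fun W => ?_)
  have h2 := Subspace.finrank_add_finrank_dualAnnihilator_eq W
  rw [Module.finrank_fin_fun] at h2
  change _ ↔ Module.finrank κ W.dualAnnihilator = a
  omega

theorem grCard_self (b : ℕ) : grCard κ b b = 1 := by
  rw [grCard, Nat.card_eq_one_iff_exists]
  refine ⟨⟨⊤, by simp⟩, fun W => Subtype.ext (Submodule.eq_top_of_finrank_eq ?_)⟩
  rw [W.2, Module.finrank_fin_fun]

theorem finrank_map_eq_of_disjoint_ker (A : V →ₗ[κ] V') {W : Submodule κ V}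
    (hW : Disjoint W (LinearMap.ker A)) :
    Module.finrank κ (W.map A) = Module.finrank κ W := by
  refine (LinearEquiv.ofBijective (A.submoduleMap W)
    ⟨?_, A.submoduleMap_surjective W⟩).finrank_eq.symm
  rw [← LinearMap.ker_eq_bot, LinearMap.ker_eq_bot']
  intro w hw
  exact Subtype.ext (Submodule.disjoint_def.1 hW w w.2 (congrArg Subtype.val hw))

/-- A map all of whose fibres have `c` elements. -/
theorem natCard_eq_mul_of_fiber {α β : Type*} [Finite α] [Finite β] (f : α → β) (c : ℕ)
    (h : ∀ b, Nat.card {a // f a = b} = c) : Nat.card α = Nat.card β * c := by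
  have := Fintype.ofFinite β
  rw [← Nat.card_congr (Equiv.sigmaFiberEquiv f), Nat.card_sigma, Finset.sum_congr rfl
    fun b _ => h b]
  simp

variable [Finite κ] [FiniteDimensional κ V]

/-- The subspaces mapped isomorphically onto a given `U ≤ range A` are the images of the sections
of `A` over `U`, which form a torsor under `Hom(U, ker A)`. -/
theorem natCard_disjoint_ker_map_eq (A : V →ₗ[κ] V') {U : Submodule κ V'}
    (hU : U ≤ LinearMap.range A) :
    Nat.card {W : Submodule κ V // Disjoint W (LinearMap.ker A) ∧ W.map A = U} =
      Nat.card κ ^ (Module.finrank κ U * Module.finrank κ (LinearMap.ker A)) := by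
  have : FiniteDimensional κ U := Submodule.finiteDimensional_of_le hU
  obtain ⟨s₀, hs₀⟩ := Module.projective_lifting_property A.rangeRestrict
    (Submodule.inclusion hU) A.surjective_rangeRestrict
  have hs₀' : ∀ u, A (s₀ u) = u := fun u => congrArg Subtype.val (LinearMap.congr_fun hs₀ u)
  have hsec : ∀ (t : U →ₗ[κ] LinearMap.ker A) (u : U), A (s₀ u + t u) = u := by
    intro t u
    rw [map_add, hs₀', (t u).2, add_zero]
  let Φ : (U →ₗ[κ] LinearMap.ker A) →
      {W : Submodule κ V // Disjoint W (LinearMap.ker A) ∧ W.map A = U} := fun t =>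
    ⟨LinearMap.range (s₀ + (LinearMap.ker A).subtype ∘ₗ t), by
      refine ⟨Submodule.disjoint_def.2 ?_, ?_⟩
      · rintro _ ⟨u, rfl⟩ hu
        have h0 : (u : V') = 0 := (hsec t u).symm.trans hu
        rw [Subtype.ext (a1 := u) (a2 := 0) h0, map_zero]
      · ext v
        constructor
        · rintro ⟨_, ⟨u, rfl⟩, rfl⟩
          exact (hsec t u).symm ▸ u.2
        · intro hv
          exact ⟨_, ⟨⟨v, hv⟩, rfl⟩, hsec t ⟨v, hv⟩⟩⟩
  have hΦ : Function.Bijective Φ := by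
    constructor
    · intro t t' h
      have hr : LinearMap.range (s₀ + (LinearMap.ker A).subtype ∘ₗ t) =
        LinearMap.range (s₀ + (LinearMap.ker A).subtype ∘ₗ t') := congrArg Subtype.val h
      ext u
      obtain ⟨u', hu'⟩ : (s₀ + (LinearMap.ker A).subtype ∘ₗ t) u ∈
        LinearMap.range (s₀ + (LinearMap.ker A).subtype ∘ₗ t') := hr ▸ ⟨u, rfl⟩
      have h1 : u' = u := Subtype.ext ((hsec t' u').symm.trans ((congrArg A hu').trans (hsec t u)))
      subst h1
      exact (add_left_cancel (a := s₀ u') hu').symm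
    · rintro ⟨W, hW, rfl⟩
      have hinj : Function.Injective (A.submoduleMap W) := by
        rw [← LinearMap.ker_eq_bot, LinearMap.ker_eq_bot']
        intro w hw
        exact Subtype.ext (Submodule.disjoint_def.1 hW w w.2 (congrArg Subtype.val hw))
      let σ := LinearEquiv.ofBijective (A.submoduleMap W) ⟨hinj, A.submoduleMap_surjective W⟩
      have hσ : ∀ u, A (σ.symm u) = u := fun u => congrArg Subtype.val (σ.apply_symm_apply u)
      let t : W.map A →ₗ[κ] LinearMap.ker A :=
        (W.subtype ∘ₗ σ.symm.toLinearMap - s₀).codRestrict _ fun u => by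
          rw [LinearMap.mem_ker, LinearMap.sub_apply, map_sub, hs₀']
          exact sub_eq_zero.2 (hσ u)
      refine ⟨t, Subtype.ext ?_⟩
      have : s₀ + (LinearMap.ker A).subtype ∘ₗ t = W.subtype ∘ₗ σ.symm.toLinearMap := by
        ext u
        simp [t]
      change LinearMap.range (s₀ + (LinearMap.ker A).subtype ∘ₗ t) = W
      rw [this, LinearMap.range_comp_of_range_eq_top _ σ.symm.range, Submodule.range_subtype]
  have := Module.finite_of_finite κ (M := U)
  rw [← Nat.card_eq_of_bijective Φ hΦ, Module.natCard_eq_pow_finrank (K := κ),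
    Module.finrank_linearMap]

/-- The number of `m`-dimensional subspaces meeting the kernel of `A` trivially. -/
theorem natCard_disjoint_ker (A : V →ₗ[κ] V') (m : ℕ) :
    Nat.card {W : Submodule κ V // Module.finrank κ W = m ∧ Disjoint W (LinearMap.ker A)} =
      grCard κ m (Module.finrank κ (LinearMap.range A)) *
        Nat.card κ ^ (m * Module.finrank κ (LinearMap.ker A)) := by
  have hfin : Finite V := Module.finite_of_finite κ
  have hgr : Nat.card {U : Submodule κ (LinearMap.range A) // Module.finrank κ U = m} =
    grCard κ m (Module.finrank κ (LinearMap.range A)) := natCard_finrank_eq_grCard m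
  rw [← hgr]
  have hsurj := A.surjective_rangeRestrict
  have hker : LinearMap.ker A.rangeRestrict = LinearMap.ker A := A.ker_rangeRestrict
  have hfinr : Finite (LinearMap.range A) := Finite.of_surjective _ hsurj
  have hrank : ∀ W : Submodule κ V, Disjoint W (LinearMap.ker A) →
      Module.finrank κ (W.map A.rangeRestrict) = Module.finrank κ W := fun W hW =>
    finrank_map_eq_of_disjoint_ker _ (hker.symm ▸ hW)
  refine natCard_eq_mul_of_fiber
    (f := fun W => ⟨W.1.map A.rangeRestrict, (hrank W.1 W.2.2).trans W.2.1⟩) _ fun U => ?_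
  have hUr : U.1 ≤ LinearMap.range A.rangeRestrict := by
    rw [LinearMap.range_eq_top.2 hsurj]; exact le_top
  have := natCard_disjoint_ker_map_eq A.rangeRestrict hUr
  rw [U.2, hker] at this
  rw [← this]
  refine Nat.card_congr ⟨fun W => ⟨W.1.1, W.1.2.2, congrArg Subtype.val W.2⟩,
    fun W => ⟨⟨W.1, ?_, W.2.1⟩, Subtype.ext W.2.2⟩, fun W => rfl, fun W => rfl⟩
  rw [← hrank W.1 W.2.1, W.2.2, U.2]

end Subspaces

/-! ### Lowering a type -/

section PredParts

/-- The type of `π (L / M)` when `L / M` has type `k`: every part is lowered by `1`. -/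
def predParts (k : Multiset ℕ) : Multiset ℕ := (k.map fun a => a - 1).filter (0 < ·)

theorem predParts_add (k k' : Multiset ℕ) : predParts (k + k') = predParts k + predParts k' := by
  simp [predParts]

theorem predParts_sum {ι : Type*} (s : Finset ι) (k : ι → Multiset ℕ) :
    predParts (∑ i ∈ s, k i) = ∑ i ∈ s, predParts (k i) :=
  map_sum (⟨⟨predParts, rfl⟩, predParts_add⟩ : Multiset ℕ →+ Multiset ℕ) k s

theorem predParts_replicate_one (c : ℕ) : predParts (Multiset.replicate c 1) = 0 := by
  simp [predParts, Multiset.filter_eq_nil, Multiset.mem_replicate]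

theorem predParts_replicate (c : ℕ) {a : ℕ} (ha : 2 ≤ a) :
    predParts (Multiset.replicate c a) = Multiset.replicate c (a - 1) := by
  rw [predParts, Multiset.map_replicate, Multiset.filter_eq_self]
  intro b hb
  rw [Multiset.eq_of_mem_replicate hb]
  omega

theorem predParts_posParts {n : ℕ} (e : Fin n → ℕ) :
    predParts (posParts e) = posParts fun i => e i - 1 := by
  have key : ∀ s : Multiset ℕ, ((s.filter (0 < ·)).map fun a => a - 1).filter (0 < ·) =
      (s.map fun a => a - 1).filter (0 < ·) := by
    intro s
    induction s using Multiset.induction_on with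
    | empty => simp
    | cons a s ih =>
      rcases a with _ | a
      · simpa using ih
      · simp only [Multiset.filter_cons, Multiset.map_cons, Multiset.map_add, Multiset.filter_add]
        simp [ih, Multiset.filter_singleton]
  rw [predParts, posParts, posParts, key, Multiset.map_map]
  rfl

theorem eq_map_predParts_add {k : Multiset ℕ} (hk : ∀ i ∈ k, 1 ≤ i) :
    k = (predParts k).map (· + 1) +
      Multiset.replicate (Multiset.card k - Multiset.card (predParts k)) 1 := by
  have h := Multiset.filter_add_not (0 < ·) (k.map fun a => a - 1)
  have h0 : (k.map fun a => a - 1).filter (fun a => ¬ 0 < a) =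
      Multiset.replicate (Multiset.card k - Multiset.card (predParts k)) 0 := by
    refine Multiset.eq_replicate.2 ⟨?_, fun b hb => by simpa using (Multiset.mem_filter.1 hb).2⟩
    have := congrArg Multiset.card h
    rw [Multiset.card_add, Multiset.card_map] at this
    simp only [predParts] at this ⊢
    omega
  rw [h0] at h
  have h1 : (k.map fun a => a - 1).map (· + 1) = k := by
    rw [Multiset.map_map]
    conv_rhs => rw [← Multiset.map_id k]
    refine Multiset.map_congr rfl fun a ha => ?_
    have := hk a ha
    simp only [Function.comp_apply, id]
    omega
  conv_lhs => rw [← h1, ← h, Multiset.map_add, Multiset.map_replicate]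
  rfl

theorem eq_of_predParts_eq {k k' : Multiset ℕ} (hk : ∀ i ∈ k, 1 ≤ i) (hk' : ∀ i ∈ k', 1 ≤ i)
    (h : predParts k = predParts k') (hc : Multiset.card k = Multiset.card k') : k = k' := by
  rw [eq_map_predParts_add hk, eq_map_predParts_add hk', h, hc]

end PredParts

/-! ### The number of sublattices of a given type -/

section Counting

open IsLocalRing

variable {R : Type*} [CommRing R] [IsDomain R] [IsDiscreteValuationRing R] {n : ℕ}

theorem HasType.diagLattice_le {M : Submodule R (Fin n → R)} {k : Multiset ℕ} (h : HasType M k) :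
    diagLattice R (fun _ => k.sum) ≤ M := by
  obtain ⟨ϖ, hϖ⟩ := IsDiscreteValuationRing.exists_irreducible R
  intro x hx
  rw [mem_diagLattice] at hx
  simp only [hϖ.maximalIdeal_eq, Ideal.span_singleton_pow, Ideal.mem_span_singleton] at hx
  choose y hy using hx
  have : x = ϖ ^ k.sum • y := funext hy
  exact this ▸ h.pow_sum_smul_mem hϖ y

/-- The lattice `(M : ϖ)`. -/
def lowerLattice (ϖ : R) (M : Submodule R (Fin n → R)) : Submodule R (Fin n → R) :=
  M.comap (LinearMap.lsmul R (Fin n → R) ϖ)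

omit [IsDomain R] [IsDiscreteValuationRing R] in
theorem mem_lowerLattice {ϖ : R} {M : Submodule R (Fin n → R)} {x : Fin n → R} :
    x ∈ lowerLattice ϖ M ↔ ϖ • x ∈ M := Iff.rfl

omit [IsDomain R] [IsDiscreteValuationRing R] in
theorem lowerLattice_map (ϖ : R) (M : Submodule R (Fin n → R))
    (g : (Fin n → R) ≃ₗ[R] (Fin n → R)) :
    lowerLattice ϖ (M.map (g : (Fin n → R) →ₗ[R] (Fin n → R))) =
      (lowerLattice ϖ M).map (g : (Fin n → R) →ₗ[R] (Fin n → R)) := by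
  ext x
  rw [mem_lowerLattice, Submodule.mem_map_equiv, Submodule.mem_map_equiv, mem_lowerLattice,
    map_smul]

theorem lowerLattice_diagLattice {ϖ : R} (hϖ : Irreducible ϖ) (e : Fin n → ℕ) :
    lowerLattice ϖ (diagLattice R e) = diagLattice R fun i => e i - 1 := by
  ext x
  rw [mem_lowerLattice, mem_diagLattice, mem_diagLattice]
  refine forall_congr' fun i => ?_
  rw [← pow_mul_mem_maximalIdeal_pow hϖ 1, pow_one]
  rfl

theorem reduceVec_eq_iff {ϖ : R} (hϖ : Irreducible ϖ)
    {y z : Fin n → R} :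
    reduceVec R n y = reduceVec R n z ↔ ∃ w, y = z + ϖ • w := by
  rw [← sub_eq_zero, ← map_sub, reduceVec_eq_zero, hϖ.maximalIdeal_eq]
  simp only [Ideal.mem_span_singleton]
  constructor
  · intro h
    choose w hw using h
    exact ⟨w, by rw [← sub_eq_iff_eq_add']; exact funext hw⟩
  · rintro ⟨w, rfl⟩ i
    exact ⟨w i, by simp⟩

/-- A lattice in elementary divisor form, as the image of an explicit endomorphism of `Rⁿ`. -/
theorem exists_range_mulVecLin_eq {ϖ : R} (hϖ : Irreducible ϖ)
    (u : (Matrix (Fin n) (Fin n) R)ˣ) (e : Fin n → ℕ) :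
    LinearMap.range (u.1 * Matrix.diagonal fun i => ϖ ^ e i).mulVecLin =
      (diagLattice R e).map (unitsLin u : (Fin n → R) →ₗ[R] (Fin n → R)) := by
  rw [Matrix.mulVecLin_mul, LinearMap.range_comp, coe_unitsLin]
  congr 1
  ext x
  rw [mem_diagLattice]
  simp only [hϖ.maximalIdeal_eq, Ideal.span_singleton_pow, Ideal.mem_span_singleton,
    LinearMap.mem_range, Matrix.mulVecLin_apply]
  constructor
  · rintro ⟨y, rfl⟩ i
    exact ⟨y i, Matrix.mulVec_diagonal _ _ _⟩
  · intro h
    choose y hy using h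
    exact ⟨y, funext fun i => (Matrix.mulVec_diagonal _ _ _).trans (hy i).symm⟩

omit [IsDomain R] [IsDiscreteValuationRing R] in
theorem det_mul_diagonal_pow {ϖ : R} (u : (Matrix (Fin n) (Fin n) R)ˣ) (e : Fin n → ℕ) :
    Associated (u.1 * Matrix.diagonal fun i => ϖ ^ e i).det (ϖ ^ (posParts e).sum) := by
  rw [Matrix.det_mul, Matrix.det_diagonal, Finset.prod_pow_eq_pow_sum, sum_posParts]
  exact associated_unit_mul_left _ _ ((Matrix.isUnit_iff_isUnit_det _).1 u.isUnit)

variable [Finite (ResidueField R)]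

theorem HasType.finite_quotient {M : Submodule R (Fin n → R)} {k : Multiset ℕ} (h : HasType M k) :
    Finite ((Fin n → R) ⧸ M) := by
  obtain ⟨ϖ, hϖ⟩ := IsDiscreteValuationRing.exists_irreducible R
  have h1 := natCard_range_lsmul_of_hasType hϖ 0 h
  rw [pow_zero] at h1
  have h2 : LinearMap.range (LinearMap.lsmul R ((Fin n → R) ⧸ M) 1) = ⊤ :=
    LinearMap.range_eq_top.2 fun x => ⟨x, by simp⟩
  rw [h2] at h1
  have h3 : Finite (⊤ : Submodule R ((Fin n → R) ⧸ M)) := by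
    refine Nat.finite_of_card_ne_zero ?_
    rw [h1]
    exact pow_ne_zero _ (one_lt_natCard_residueField (R := R)).ne_bot
  exact Finite.of_equiv _ (Submodule.topEquiv (R := R) (M := (Fin n → R) ⧸ M)).toEquiv

theorem finite_hasType (k : Multiset ℕ) :
    Finite {M : Submodule R (Fin n → R) // HasType M k} := by
  let D := diagLattice R (n := n) fun _ => k.sum
  have : Finite ((Fin n → R) ⧸ D) := (hasType_diagLattice R _).finite_quotient
  refine Finite.of_injective (fun M : {M : Submodule R (Fin n → R) // HasType M k} =>
    M.1.map D.mkQ) fun M M' h => Subtype.ext ?_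
  have h' := congrArg (Submodule.comap D.mkQ) h
  simpa [Submodule.comap_map_mkQ, sup_eq_right.2 M.2.diagLattice_le,
    sup_eq_right.2 M'.2.diagLattice_le, D] using h'

theorem HasType.lowerLattice {ϖ : R} (hϖ : Irreducible ϖ) {M : Submodule R (Fin n → R)}
    {k : Multiset ℕ} (h : HasType M k) : HasType (lowerLattice ϖ M) (predParts k) := by
  obtain ⟨u, e, rfl, rfl⟩ := hasType_iff.1 h
  rw [lowerLattice_map, lowerLattice_diagLattice hϖ, predParts_posParts]
  exact (hasType_diagLattice R _).map_linearEquiv _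

theorem hasType_iff_lowerLattice {ϖ : R} (hϖ : Irreducible ϖ) {M : Submodule R (Fin n → R)}
    {k : Multiset ℕ} (hk : ∀ i ∈ k, 1 ≤ i) (hn : Multiset.card k ≤ n) :
    HasType M k ↔ HasType (lowerLattice ϖ M) (predParts k) ∧
      Module.finrank (ResidueField R) (reduceLattice M) = n - Multiset.card k := by
  constructor
  · intro h
    have := h.finrank_reduceLattice_add_card
    exact ⟨h.lowerLattice hϖ, by omega⟩
  · rintro ⟨h, hd⟩
    obtain ⟨u, e, hM⟩ := exists_eq_map_diagLattice (M := M)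
      (pow_ne_zero ((predParts k).sum + 1) hϖ.ne_zero) fun x => by
        have := h.pow_sum_smul_mem hϖ x
        rwa [mem_lowerLattice, smul_smul, ← pow_succ'] at this
    have h' : HasType M (posParts e) := hasType_iff.2 ⟨u, e, hM, rfl⟩
    have h1 := (h'.lowerLattice hϖ).unique h
    have h2 := h'.finrank_reduceLattice_add_card
    rwa [← eq_of_predParts_eq h'.1 hk h1 (by omega)]

/-- For `N = φ(L)`, the lattices `M` with `(M : ϖ) = N` and `dim M̄ = m` are the `φ(W̃)`, with `W̃`
the preimage in `L` of an `m`-dimensional subspace `W` of `κⁿ` meeting the kernel of `φ̄`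
trivially. -/
theorem natCard_lowerLattice_eq {ϖ : R} (hϖ : Irreducible ϖ) {N : Submodule R (Fin n → R)}
    {k : Multiset ℕ} (hN : HasType N k) (m : ℕ) :
    Nat.card {M : Submodule R (Fin n → R) // lowerLattice ϖ M = N ∧
        Module.finrank (ResidueField R) (reduceLattice M) = m} =
      grCard (ResidueField R) m (n - Multiset.card k) *
        Nat.card (ResidueField R) ^ (m * Multiset.card k) := by
  obtain ⟨u, e, hue, rfl⟩ := hasType_iff.1 hN
  let φ : Matrix (Fin n) (Fin n) R := u.1 * Matrix.diagonal fun i => ϖ ^ e i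
  have hr : LinearMap.range φ.mulVecLin = N :=
    (exists_range_mulVecLin_eq hϖ u e).trans hue.symm
  have hdet : φ.det ≠ 0 := (det_mul_diagonal_pow u e).ne_zero_iff.2 (pow_ne_zero _ hϖ.ne_zero)
  have hinj : ∀ x y, φ.mulVec x = φ.mulVec y → x = y := by
    intro x y hxy
    refine sub_eq_zero.1 (Matrix.eq_zero_of_mulVec_eq_zero hdet ?_)
    rw [Matrix.mulVec_sub, hxy, sub_self]
  let A := (φ.map (residue R)).mulVecLin
  have hA : reduceLattice N = LinearMap.range A := by rw [← hr, reduceLattice_range]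
  have hrank := hN.finrank_reduceLattice_add_card
  have hker := A.finrank_range_add_finrank_ker
  rw [← hA, Module.finrank_fin_fun] at hker
  have hcount := natCard_disjoint_ker A m
  rw [← hA, show Module.finrank (ResidueField R) (reduceLattice N) =
    n - Multiset.card (posParts e) by omega,
    show Module.finrank (ResidueField R) (LinearMap.ker A) = Multiset.card (posParts e) by omega]
    at hcount
  rw [← hcount]
  have hsurj : RingHomSurjective (residue R) := ⟨residue_surjective⟩
  let toM : Submodule (ResidueField R) (Fin n → ResidueField R) → Submodule R (Fin n → R) :=
    fun W => (W.comap (reduceVec R n)).map φ.mulVecLin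
  let toW : Submodule R (Fin n → R) → Submodule (ResidueField R) (Fin n → ResidueField R) :=
    fun M => reduceLattice (M.comap φ.mulVecLin)
  have htoM : ∀ W y, φ.mulVec y ∈ toM W ↔ reduceVec R n y ∈ W := by
    intro W y
    constructor
    · rintro ⟨z, hz, hzy⟩
      rw [← hinj z y hzy]
      exact hz
    · exact fun h => ⟨y, h, rfl⟩
  have hred : ∀ W, reduceLattice (toM W) = W.map A := by
    intro W
    rw [reduceLattice_map_mulVecLin]
    congr 1
    exact Submodule.map_comap_eq_of_surjective reduceVec_surjective W
  have hlow : ∀ W, Disjoint W (LinearMap.ker A) ↔ lowerLattice ϖ (toM W) = N := by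
    intro W
    rw [← hr]
    constructor
    · intro hW
      ext x
      rw [mem_lowerLattice]
      constructor
      · rintro ⟨y, hy, hyx⟩
        rw [Matrix.mulVecLin_apply] at hyx
        have h1 : reduceVec R n y ∈ LinearMap.ker A := by
          rw [LinearMap.mem_ker, Matrix.mulVecLin_apply, ← reduceVec_mulVec, hyx, ← map_zero
            (reduceVec R n), reduceVec_eq_iff hϖ]
          exact ⟨x, (zero_add _).symm⟩
        have h2 := Submodule.disjoint_def.1 hW _ hy h1
        rw [← map_zero (reduceVec R n), reduceVec_eq_iff hϖ] at h2
        obtain ⟨w, hw⟩ := h2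
        rw [hw, zero_add, Matrix.mulVec_smul] at hyx
        exact ⟨w, smul_right_injective _ hϖ.ne_zero hyx⟩
      · rintro ⟨w, rfl⟩
        rw [← map_smul, Matrix.mulVecLin_apply, htoM,
          (reduceVec_eq_iff hϖ (z := 0)).2 ⟨w, (zero_add _).symm⟩, map_zero]
        exact W.zero_mem
    · intro hl
      refine Submodule.disjoint_def.2 fun v hv hv0 => ?_
      obtain ⟨y, rfl⟩ := reduceVec_surjective v
      rw [LinearMap.mem_ker, Matrix.mulVecLin_apply, ← reduceVec_mulVec, ← map_zero
        (reduceVec R n), reduceVec_eq_iff hϖ] at hv0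
      obtain ⟨x, hx⟩ := hv0
      rw [zero_add] at hx
      have hx' : x ∈ lowerLattice ϖ (toM W) := by
        rw [mem_lowerLattice, ← hx, htoM]
        exact hv
      rw [hl] at hx'
      obtain ⟨z, rfl⟩ := hx'
      rw [Matrix.mulVecLin_apply, ← Matrix.mulVec_smul] at hx
      rw [hinj _ _ hx, (reduceVec_eq_iff hϖ (z := 0)).2 ⟨z, (zero_add _).symm⟩, map_zero]
  have hWM : ∀ W, toW (toM W) = W := by
    intro W
    ext v
    constructor
    · rintro ⟨y, hy, rfl⟩
      exact (htoM W y).1 hy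
    · intro hv
      obtain ⟨y, rfl⟩ := reduceVec_surjective v
      exact ⟨y, (htoM W y).2 hv, rfl⟩
  have hMW : ∀ M, lowerLattice ϖ M = N → toM (toW M) = M := by
    intro M hM
    rw [← hr] at hM
    ext x
    constructor
    · rintro ⟨y, ⟨z, hz, hzy⟩, rfl⟩
      obtain ⟨w, rfl⟩ := (reduceVec_eq_iff hϖ).1 hzy.symm
      rw [map_add, map_smul]
      refine M.add_mem hz ?_
      have : φ.mulVecLin w ∈ lowerLattice ϖ M := hM ▸ ⟨w, rfl⟩
      exact this
    · intro hx
      have : x ∈ lowerLattice ϖ M := M.smul_mem ϖ hx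
      rw [hM] at this
      obtain ⟨y, rfl⟩ := this
      exact (htoM _ y).2 ⟨y, hx, rfl⟩
  refine Nat.card_congr ⟨fun M => ⟨toW M.1, ?_⟩, fun W => ⟨toM W.1, ?_⟩, fun M => ?_, fun W => ?_⟩
  · have hd : Disjoint (toW M.1) (LinearMap.ker A) := (hlow _).2 (by rw [hMW _ M.2.1, M.2.1])
    refine ⟨?_, hd⟩
    rw [← finrank_map_eq_of_disjoint_ker _ hd, ← hred, hMW _ M.2.1, M.2.2]
  · exact ⟨(hlow _).1 W.2.2, by rw [hred, finrank_map_eq_of_disjoint_ker _ W.2.2, W.2.1]⟩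
  · exact Subtype.ext (hMW _ M.2.1)
  · exact Subtype.ext (hWM _)

/-- The recursion for the number of sublattices of a given type, by way of `M ↦ (M : ϖ)`. -/
theorem typeCount_eq_typeCount_predParts_mul {k : Multiset ℕ} (hk : ∀ i ∈ k, 1 ≤ i)
    (hn : Multiset.card k ≤ n) :
    typeCount R n k = typeCount R n (predParts k) *
      (grCard (ResidueField R) (n - Multiset.card k) (n - Multiset.card (predParts k)) *
        Nat.card (ResidueField R) ^ ((n - Multiset.card k) * Multiset.card (predParts k))) := by
  obtain ⟨ϖ, hϖ⟩ := IsDiscreteValuationRing.exists_irreducible R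
  have := finite_hasType (R := R) (n := n) k
  have := finite_hasType (R := R) (n := n) (predParts k)
  refine natCard_eq_mul_of_fiber (f := fun M => ⟨lowerLattice ϖ M.1, M.2.lowerLattice hϖ⟩) _
    fun N => ?_
  rw [← natCard_lowerLattice_eq hϖ N.2]
  refine Nat.card_congr ⟨fun M => ⟨M.1.1, congrArg Subtype.val M.2,
    ((hasType_iff_lowerLattice hϖ hk hn).1 M.1.2).2⟩,
    fun M => ⟨⟨M.1, (hasType_iff_lowerLattice hϖ hk hn).2 ⟨by rw [M.2.1]; exact N.2, M.2.2⟩⟩,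
      Subtype.ext M.2.1⟩, fun M => rfl, fun M => rfl⟩

omit [Finite (ResidueField R)] in
theorem typeCount_zero : typeCount R n 0 = 1 := by
  rw [typeCount, Nat.card_eq_one_iff_exists]
  have hiff : ∀ M : Submodule R (Fin n → R), HasType M 0 ↔ M = ⊤ := by
    intro M
    have hs : Subsingleton ((Fin n → R) ⧸ M) ↔ M = ⊤ := by
      rw [← Submodule.unique_quotient_iff_eq_top, unique_iff_subsingleton_and_nonempty]
      exact (and_iff_left ⟨0⟩).symm
    rw [← hs]
    have : IsEmpty (0 : Multiset ℕ).ToType := Fintype.card_eq_zero_iff.1 (by simp)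
    constructor
    · rintro ⟨-, ⟨f⟩⟩
      exact f.toEquiv.subsingleton
    · intro h
      exact ⟨by simp, ⟨LinearEquiv.ofSubsingleton _ _⟩⟩
  exact ⟨⟨⊤, (hiff _).2 rfl⟩, fun M => Subtype.ext ((hiff _).1 M.2)⟩

theorem typeCount_formula_range (N : ℕ) : ∀ (l : ℕ) (r mult : ℕ → ℕ), r l = N → r 0 = 0 →
    (∀ i < l, r i < r (i + 1)) → ∑ j ∈ Finset.range (l + 1), mult j = n →
    typeCount R n (∑ i ∈ Finset.range l, Multiset.replicate (mult (i + 1)) (r (i + 1))) =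
      ∏ i ∈ Finset.range l,
        grCard (ResidueField R) (mult (i + 1)) (∑ j ∈ Finset.range (i + 2), mult j) *
        Nat.card (ResidueField R) ^
          (((r (i + 1) - r i - 1) * (n - ∑ j ∈ Finset.range (i + 1), mult j) +
            (n - ∑ j ∈ Finset.range (i + 2), mult j)) * ∑ j ∈ Finset.range (i + 1), mult j) := by
  induction N with
  | zero =>
    rintro l r mult hl h0 hr -
    rcases l with _ | l
    · simpa using typeCount_zero
    · have := hr l (Nat.lt_succ_self l)
      omega
  | succ N ih =>
    intro l r mult hl h0 hr hn
    rcases l with _ | l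
    · omega
    have hr1 : ∀ i ≤ l, r 1 ≤ r (i + 1) := by
      intro i
      induction i with
      | zero => simp
      | succ i ihi =>
        intro hi
        exact (ihi (by omega)).trans (hr (i + 1) (by omega)).le
    have hr01 := hr 0 (by omega)
    rw [h0, zero_add] at hr01
    set k := ∑ i ∈ Finset.range (l + 1), Multiset.replicate (mult (i + 1)) (r (i + 1)) with hkdef
    have hk : ∀ a ∈ k, 1 ≤ a := by
      intro a ha
      obtain ⟨i, hi, hai⟩ := Multiset.mem_sum.1 ha
      rw [Multiset.eq_of_mem_replicate hai]
      exact hr01.trans_le (hr1 i (by simpa [Nat.lt_succ_iff] using hi))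
    have hcard : Multiset.card k + mult 0 = n := by
      rw [hkdef, Multiset.card_sum, ← hn, Finset.sum_range_succ' mult (l + 1)]
      simp
    rw [typeCount_eq_typeCount_predParts_mul hk (by omega), show n - Multiset.card k = mult 0 by
      omega, Finset.prod_range_succ']
    simp only [zero_add, Finset.sum_range_one, h0, Nat.sub_zero]
    rcases Nat.lt_or_ge (r 1) 2 with h1 | h1
    · -- the parts equal to `1` disappear
      have h1 : r 1 = 1 := by omega
      have hpred : predParts k = ∑ i ∈ Finset.range l,
          Multiset.replicate (mult (i + 2)) (r (i + 2) - 1) := by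
        rw [hkdef, predParts_sum, Finset.sum_range_succ', zero_add, h1, predParts_replicate_one,
          add_zero]
        refine Finset.sum_congr rfl fun i hi => predParts_replicate _ ?_
        have := hr (i + 1) (by have := Finset.mem_range.1 hi; omega)
        have := hr1 i (by have := Finset.mem_range.1 hi; omega)
        omega
      let mult' : ℕ → ℕ := fun j => if j = 0 then mult 0 + mult 1 else mult (j + 1)
      have hsum : ∀ i, ∑ j ∈ Finset.range (i + 1), mult' j =
          ∑ j ∈ Finset.range (i + 2), mult j := by
        intro i
        rw [Finset.sum_range_succ', Finset.sum_range_succ' mult, Finset.sum_range_succ']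
        simp only [mult', if_true, Nat.succ_ne_zero, if_false]
        ring
      have := ih l (fun i => r (i + 1) - 1) mult' (by omega) (by simp [h1])
        (fun i hi => by
          have := hr (i + 1) (by omega)
          have := hr1 i (by omega)
          omega) (by rw [hsum, hn])
      simp only [hsum] at this
      have hcard' : Multiset.card (predParts k) + (mult 0 + mult 1) = n := by
        rw [hpred, Multiset.card_sum, ← hn, Finset.sum_range_succ', Finset.sum_range_succ']
        simp
        ring
      have hgr := grCard_sub (κ := ResidueField R) (Nat.le_add_right (mult 0) (mult 1))
      rw [Nat.add_sub_cancel_left] at hgr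
      have hS2 : ∑ j ∈ Finset.range 2, mult j = mult 0 + mult 1 := by
        rw [Finset.sum_range_succ, Finset.sum_range_one]
      rw [show n - Multiset.card (predParts k) = mult 0 + mult 1 by omega, ← hgr, hS2, hpred]
      rw [hpred] at hcard'
      rw [show n - (mult 0 + mult 1) = Multiset.card (∑ i ∈ Finset.range l,
          Multiset.replicate (mult (i + 2)) (r (i + 2) - 1)) by omega, h1]
      have hm : ∀ i, mult' (i + 1) = mult (i + 2) := fun i => rfl
      simp only [hm] at this
      rw [this]
      congr 1
      · refine Finset.prod_congr rfl fun i hi => ?_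
        have := hr1 i (by have := Finset.mem_range.1 hi; omega)
        rw [show r (i + 1 + 1) - 1 - (r (i + 1) - 1) - 1 = r (i + 1 + 1) - r (i + 1) - 1 by omega]
      · simp [mul_comm]
    · -- every part drops by `1` without changing the multiplicities
      have hpred : predParts k = ∑ i ∈ Finset.range (l + 1),
          Multiset.replicate (mult (i + 1)) (r (i + 1) - 1) := by
        rw [hkdef, predParts_sum]
        refine Finset.sum_congr rfl fun i hi => predParts_replicate _ ?_
        exact h1.trans (hr1 i (by have := Finset.mem_range.1 hi; omega))
      have := ih (l + 1) (fun i => r i - 1) mult (by omega) (by simp [h0])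
        (fun i hi => by
          have := hr i hi
          have := hr1 i (by omega)
          omega) hn
      have hcard' : Multiset.card (predParts k) = Multiset.card k := by
        rw [hpred, hkdef, Multiset.card_sum, Multiset.card_sum]
        simp
      rw [hcard', show n - Multiset.card k = mult 0 by omega, grCard_self, one_mul, hpred, this,
        Finset.prod_range_succ', mul_assoc]
      congr 1
      · refine Finset.prod_congr rfl fun i hi => ?_
        have := hr1 i (by have := Finset.mem_range.1 hi; omega)
        rw [show r (i + 1 + 1) - 1 - (r (i + 1) - 1) - 1 = r (i + 1 + 1) - r (i + 1) - 1 by omega]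
      · simp only [zero_add, Finset.sum_range_one, h0, Nat.zero_sub, Nat.sub_zero]
        rw [mul_assoc, ← pow_add]
        congr 2
        obtain ⟨c, hc⟩ := Nat.exists_eq_add_of_le h1
        rw [hc, show n - mult 0 = Multiset.card k by omega, show 2 + c - 1 - 1 = c by omega,
          show 2 + c - 1 = c + 1 by omega]
        ring

theorem typeCount_formula (l : ℕ) (r mult : ℕ → ℕ) (h0 : r 0 = 0)
    (hr : ∀ i < l, r i < r (i + 1)) (hn : ∑ j ∈ Finset.range (l + 1), mult j = n) :
    typeCount R n (∑ i ∈ Finset.Icc 1 l, Multiset.replicate (mult i) (r i)) =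
      ∏ i ∈ Finset.Icc 1 l,
        grCard (ResidueField R) (mult i) (∑ j ∈ Finset.range (i + 1), mult j) *
        Nat.card (ResidueField R) ^
          (((r i - r (i - 1) - 1) * (n - ∑ j ∈ Finset.range i, mult j) +
            (n - ∑ j ∈ Finset.range (i + 1), mult j)) * ∑ j ∈ Finset.range i, mult j) := by
  have hIcc : Finset.Icc 1 l = (Finset.range l).image (· + 1) := by
    ext i
    simp only [Finset.mem_Icc, Finset.mem_image, Finset.mem_range]
    exact ⟨fun h => ⟨i - 1, by omega, by omega⟩, by rintro ⟨j, hj, rfl⟩; omega⟩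
  have hinj : Set.InjOn (· + 1) (Finset.range l : Set ℕ) := fun a _ b _ h => Nat.succ_injective h
  rw [hIcc, Finset.sum_image hinj, Finset.prod_image hinj]
  exact typeCount_formula_range (r l) l r mult rfl h0 hr hn

/-- The number `d_t` of subspaces of `M̄` of codimension `t`. -/
theorem subspaceCount_eq_grCard {M : Submodule R (Fin n → R)} {k : Multiset ℕ} (h : HasType M k)
    (t : ℕ) : subspaceCount M k t = grCard (ResidueField R) t (n - Multiset.card k) := by
  have hd := h.finrank_reduceLattice_add_card
  rw [subspaceCount]
  simp only [IsSubspaceOfCodim]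
  rcases Nat.lt_or_ge (n - Multiset.card k) t with ht | ht
  · rw [Nat.card_eq_zero.2 (Or.inl ⟨fun V => by have := V.2.2; omega⟩), eq_comm, grCard,
      Nat.card_eq_zero.2 (Or.inl ⟨fun W => ?_⟩)]
    have := W.1.finrank_le
    rw [W.2, Module.finrank_fin_fun] at this
    omega
  · rw [← grCard_sub ht, show n - Multiset.card k =
      Module.finrank (ResidueField R) (reduceLattice M) by omega, ← natCard_le_finrank_eq_grCard]
    refine Nat.card_congr (Equiv.subtypeEquivRight fun V => and_congr_right fun _ => ?_)
    omega

end Counting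

/-! ### Endomorphisms with a given image -/

section Images

open IsLocalRing

theorem exists_units_mul_eq {R : Type*} [CommRing R] [IsDomain R] {n : ℕ}
    {A B : Matrix (Fin n) (Fin n) R} (hA : A.det ≠ 0)
    (h : LinearMap.range A.mulVecLin = LinearMap.range B.mulVecLin) :
    ∃ u : Matrix (Fin n) (Fin n) R, IsUnit u.det ∧ A * u = B := by
  have hfac : ∀ {A B : Matrix (Fin n) (Fin n) R},
      LinearMap.range B.mulVecLin ≤ LinearMap.range A.mulVecLin → ∃ u, A * u = B := by
    intro A B hle
    have : ∀ j, ∃ x, A.mulVec x = B.col j := fun j =>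
      hle ⟨Pi.single j 1, Matrix.mulVec_single_one B j⟩
    choose x hx using this
    refine ⟨Matrix.of fun i j => x j i, ?_⟩
    ext i j
    exact congrFun (hx j) i
  obtain ⟨u, hu⟩ := hfac h.ge
  obtain ⟨w, hw⟩ := hfac h.le
  refine ⟨u, ?_, hu⟩
  have hdet : A.det * (u.det * w.det) = A.det * 1 := by
    rw [← mul_assoc, ← Matrix.det_mul, ← Matrix.det_mul, hu, hw, mul_one]
  exact IsUnit.of_mul_eq_one _ (mul_left_cancel₀ hA hdet)

theorem charpoly_eq_of_charCoeffs_eq {R : Type*} [CommRing R] {n : ℕ}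
    {A B : Matrix (Fin n) (Fin n) R} (h : charCoeffs A = charCoeffs B) :
    A.charpoly = B.charpoly := by
  nontriviality R
  ext i
  have hdeg : ∀ A : Matrix (Fin n) (Fin n) R, A.charpoly.natDegree = n := fun A => by
    rw [Matrix.charpoly_natDegree_eq_dim, Fintype.card_fin]
  rcases lt_trichotomy i n with hi | rfl | hi
  · have := congrFun h ⟨n - 1 - i, by omega⟩
    simpa [charCoeffs, show n - 1 - (n - 1 - i) = i by omega] using this
  · have h1 := (Matrix.charpoly_monic A).coeff_natDegree
    have h2 := (Matrix.charpoly_monic B).coeff_natDegree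
    rw [hdeg] at h1 h2
    rw [h1, h2]
  · rw [Polynomial.coeff_eq_zero_of_natDegree_lt (by rwa [hdeg]),
      Polynomial.coeff_eq_zero_of_natDegree_lt (by rwa [hdeg])]

variable {R : Type*} [CommRing R] [IsDomain R] [IsDiscreteValuationRing R] {n : ℕ}

theorem exists_hasType_range {f : Matrix (Fin n) (Fin n) R} (hf : f.det ≠ 0) :
    ∃ k, HasType (LinearMap.range f.mulVecLin) k := by
  obtain ⟨u, e, hM⟩ := exists_eq_map_diagLattice (M := LinearMap.range f.mulVecLin) hf fun x =>
    ⟨f.adjugate.mulVec x, by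
      rw [Matrix.mulVecLin_apply, Matrix.mulVec_mulVec, Matrix.mul_adjugate, Matrix.smul_mulVec,
        Matrix.one_mulVec]⟩
  exact ⟨posParts e, hM ▸ (hasType_diagLattice R e).map_linearEquiv _⟩

variable [Finite (ResidueField R)]

theorem HasType.exists_matrix {M : Submodule R (Fin n → R)} {k : Multiset ℕ} (h : HasType M k) :
    ∃ A : Matrix (Fin n) (Fin n) R, LinearMap.range A.mulVecLin = M ∧
      IsDiscreteValuationRing.addVal R A.det = k.sum := by
  obtain ⟨ϖ, hϖ⟩ := IsDiscreteValuationRing.exists_irreducible R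
  obtain ⟨u, e, rfl, rfl⟩ := hasType_iff.1 h
  refine ⟨_, exists_range_mulVecLin_eq hϖ u e, ?_⟩
  rw [← hϖ.addVal_pow, IsDiscreteValuationRing.addVal_eq_iff_associated]
  exact det_mul_diagonal_pow u e

omit [Finite (ResidueField R)] in
theorem det_ne_zero_of_addVal_eq {A : Matrix (Fin n) (Fin n) R} {d : ℕ}
    (h : IsDiscreteValuationRing.addVal R A.det = d) : A.det ≠ 0 := by
  intro h0
  rw [h0, IsDiscreteValuationRing.addVal_zero] at h
  exact ENat.top_ne_natCast _ h

/-- If `L / f(L)` has type `k`, then `ord (det f) = ∑ᵢ kᵢ`. -/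
theorem HasType.addVal_det {f : Matrix (Fin n) (Fin n) R} {k : Multiset ℕ}
    (h : HasType (LinearMap.range f.mulVecLin) k) :
    IsDiscreteValuationRing.addVal R f.det = k.sum := by
  obtain ⟨A, hA, hdet⟩ := h.exists_matrix
  obtain ⟨u, hu, rfl⟩ := exists_units_mul_eq (det_ne_zero_of_addVal_eq hdet) hA
  rw [← hdet, IsDiscreteValuationRing.addVal_eq_iff_associated, Matrix.det_mul]
  exact associated_mul_unit_left _ _ hu

variable [TopologicalSpace R] [IsTopologicalRing R] [CompactSpace R] [T2Space R]

theorem isClosed_residue_preimage (S : Set (ResidueField R)) :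
    IsClosed (residue R ⁻¹' S) := by
  obtain ⟨ϖ, hϖ⟩ := IsDiscreteValuationRing.exists_irreducible R
  rw [← Set.biUnion_preimage_singleton]
  refine S.toFinite.isClosed_biUnion fun s _ => ?_
  obtain ⟨x, rfl⟩ := residue_surjective s
  have : residue R ⁻¹' {residue R x} = Set.range fun y => x + ϖ * y := by
    ext z
    rw [Set.mem_preimage, Set.mem_singleton_iff, ← sub_eq_zero, ← map_sub, residue_eq_zero_iff,
      hϖ.maximalIdeal_eq, Ideal.mem_span_singleton]
    constructor
    · rintro ⟨y, hy⟩
      exact ⟨y, by simp only [← hy]; ring⟩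
    · rintro ⟨y, rfl⟩
      exact ⟨y, by ring⟩
  rw [this]
  exact (isCompact_range (by fun_prop)).isClosed

/-- The set of endomorphisms with image `M = φ(L)` is `φ GL_n(R)`, hence compact. -/
theorem HasType.isCompact_homSet {M : Submodule R (Fin n → R)} {k : Multiset ℕ}
    (h : HasType M k) : IsCompact (homSet M) := by
  obtain ⟨A, hA, hdet⟩ := h.exists_matrix
  have hset : homSet M = (fun u => A * u) '' {u | IsUnit u.det} := by
    ext f
    constructor
    · intro hf
      obtain ⟨u, hu, rfl⟩ := exists_units_mul_eq (det_ne_zero_of_addVal_eq hdet)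
        (hA.trans hf.symm)
      exact ⟨u, hu, rfl⟩
    · rintro ⟨u, hu, rfl⟩
      obtain ⟨u, rfl⟩ := (Matrix.isUnit_iff_isUnit_det u).2 hu
      change LinearMap.range (A * u.1).mulVecLin = M
      rw [Matrix.mulVecLin_mul, ← coe_unitsLin,
        LinearMap.range_comp_of_range_eq_top _ (unitsLin u).range,
        hA]
  have hclosed : IsClosed {u : Matrix (Fin n) (Fin n) R | IsUnit u.det} := by
    have : {u : Matrix (Fin n) (Fin n) R | IsUnit u.det} =
        (fun u => u.det) ⁻¹' (residue R ⁻¹' {0}ᶜ) := by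
      ext u
      simp
    rw [this]
    exact (isClosed_residue_preimage _).preimage (continuous_id.matrix_det)
  have : CompactSpace (Matrix (Fin n) (Fin n) R) :=
    inferInstanceAs (CompactSpace (Fin n → Fin n → R))
  rw [hset]
  exact hclosed.isCompact.image (by fun_prop)

theorem isClosed_map_residue_mem (S : Set (Matrix (Fin n) (Fin n) (ResidueField R))) :
    IsClosed {f : Matrix (Fin n) (Fin n) R | f.map (residue R) ∈ S} := by
  have : {f : Matrix (Fin n) (Fin n) R | f.map (residue R) ∈ S} =
      ⋃ A ∈ S, ⋂ i, ⋂ j, (fun f : Matrix (Fin n) (Fin n) R => f i j) ⁻¹'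
        (residue R ⁻¹' {A i j}) := by
    ext f
    simp only [Set.mem_ofPred_eq, Set.mem_iUnion, Set.mem_iInter, Set.mem_preimage,
      Set.mem_singleton_iff, exists_prop]
    constructor
    · exact fun h => ⟨_, h, fun _ _ => rfl⟩
    · rintro ⟨A, hA, h⟩
      have : f.map (residue R) = A := by ext i j; exact h i j
      exact this ▸ hA
  rw [this]
  have : Finite (Matrix (Fin n) (Fin n) (ResidueField R)) :=
    inferInstanceAs (Finite (Fin n → Fin n → ResidueField R))
  exact S.toFinite.isClosed_biUnion fun A _ => isClosed_iInter fun i => isClosed_iInter fun j =>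
    (isClosed_residue_preimage _).preimage (continuous_id.matrix_elem i j)

theorem HasType.isCompact_homSetSub {M : Submodule R (Fin n → R)} {k : Multiset ℕ}
    (h : HasType M k) (V : Submodule (ResidueField R) (Fin n → ResidueField R)) :
    IsCompact (homSetSub M V) :=
  h.isCompact_homSet.inter_right
    (isClosed_map_residue_mem {A | (reduceLattice M).map A.mulVecLin = V})

end Images

/-! ### Conjugation and the strata -/

section ConjugationLattices

open IsLocalRing

variable {R : Type*} [CommRing R] [IsLocalRing R] {n : ℕ}

omit [IsLocalRing R] in
theorem range_conjLin (u : (Matrix (Fin n) (Fin n) R)ˣ) (f : Matrix (Fin n) (Fin n) R) :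
    LinearMap.range (conjLin u f).mulVecLin =
      (LinearMap.range f.mulVecLin).map (unitsLin u : (Fin n → R) →ₗ[R] (Fin n → R)) := by
  rw [conjLin_apply, Matrix.mulVecLin_mul, ← coe_unitsLin u⁻¹,
    LinearMap.range_comp_of_range_eq_top _ (unitsLin u⁻¹).range, Matrix.mulVecLin_mul,
    LinearMap.range_comp, coe_unitsLin]

omit [IsLocalRing R] in
theorem conjLin_mem_homSet_map (u : (Matrix (Fin n) (Fin n) R)ˣ) {M : Submodule R (Fin n → R)}
    {f : Matrix (Fin n) (Fin n) R} :
    conjLin u f ∈ homSet (M.map (unitsLin u : (Fin n → R) →ₗ[R] (Fin n → R))) ↔ f ∈ homSet M := by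
  change LinearMap.range _ = _ ↔ LinearMap.range _ = _
  rw [range_conjLin]
  exact (Submodule.map_injective_of_injective (unitsLin u).injective).eq_iff

theorem conjLin_mem_homSetSub_map (u : (Matrix (Fin n) (Fin n) R)ˣ) {M : Submodule R (Fin n → R)}
    {V : Submodule (ResidueField R) (Fin n → ResidueField R)} {f : Matrix (Fin n) (Fin n) R} :
    conjLin u f ∈ homSetSub (M.map (unitsLin u : (Fin n → R) →ₗ[R] (Fin n → R)))
        (V.map (unitsLin (reduceUnit u) :
          (Fin n → ResidueField R) →ₗ[ResidueField R] (Fin n → ResidueField R))) ↔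
      f ∈ homSetSub M V := by
  refine and_congr (conjLin_mem_homSet_map u) ?_
  have hmap : (conjLin u f).map (residue R) = conjLin (reduceUnit u) (f.map (residue R)) := by
    simp only [conjLin_apply, Matrix.map_mul]
    rfl
  rw [hmap, coe_unitsLin u, reduceLattice_map_mulVecLin, ← coe_reduceUnit, ← Submodule.map_comp,
    ← Matrix.mulVecLin_mul, conjLin_apply, mul_assoc, mul_assoc, Units.inv_mul, mul_one,
    Matrix.mulVecLin_mul, Submodule.map_comp, ← coe_unitsLin]
  exact (Submodule.map_injective_of_injective (unitsLin (reduceUnit u)).injective).eq_iff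

end ConjugationLattices

/-! ### Stable orbital integrals -/

section OrbitalIntegrals

open IsLocalRing

variable {F : Type*} [Field F] [ValuativeRel F] [TopologicalSpace F]
  [IsNonarchimedeanLocalField F] [MeasurableSpace F] [BorelSpace F] {n : ℕ}

instance t2Space_localField : T2Space F := by
  let := IsTopologicalAddGroup.rightUniformSpace F
  have := isUniformAddGroup_of_addCommGroup (G := F)
  have : T0Space F := inferInstance
  infer_instance

instance t2Space_matrix (E : Type*) [TopologicalSpace E] [T2Space E] (n : ℕ) :
    T2Space (Matrix (Fin n) (Fin n) E) := inferInstanceAs (T2Space (Fin n → Fin n → E))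

instance finite_residueField : Finite (ResidueField 𝒪[F]) := inferInstanceAs (Finite 𝓀[F])

theorem orbitVolume_conjLin_image (γ : Matrix (Fin n) (Fin n) 𝒪[F])
    (u : (Matrix (Fin n) (Fin n) 𝒪[F])ˣ) (S : Set (Matrix (Fin n) (Fin n) 𝒪[F])) :
    orbitVolume γ (conjLin u '' S) = orbitVolume γ S := by
  let U : (Matrix (Fin n) (Fin n) F)ˣ := Units.map (algebraMap 𝒪[F] F).mapMatrix.toMonoidHom u
  have h : ∀ f, (conjLin u f).map (algebraMap 𝒪[F] F) = conjLin U (f.map (algebraMap 𝒪[F] F)) := by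
    intro f
    simp only [conjLin_apply, Matrix.map_mul]
    rfl
  rw [orbitVolume, orbitVolume, Set.image_image, Set.image_congr fun f _ => h f,
    ← Set.image_image (conjLin U), formMeasure_conj_image]

omit [TopologicalSpace F] [IsNonarchimedeanLocalField F] [MeasurableSpace F] [BorelSpace F] in
theorem conjLin_mem_integralFibre {γ f : Matrix (Fin n) (Fin n) 𝒪[F]}
    (u : (Matrix (Fin n) (Fin n) 𝒪[F])ˣ) :
    conjLin u f ∈ integralFibre γ ↔ f ∈ integralFibre γ := by
  change charCoeffs _ = _ ↔ charCoeffs _ = _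
  rw [conjLin_apply, charCoeffs_units_conj]

theorem orbitVolume_integralFibre_inter_eq (γ : Matrix (Fin n) (Fin n) 𝒪[F])
    (u : (Matrix (Fin n) (Fin n) 𝒪[F])ˣ) {S S' : Set (Matrix (Fin n) (Fin n) 𝒪[F])}
    (h : ∀ f, conjLin u f ∈ S' ↔ f ∈ S) :
    orbitVolume γ (integralFibre γ ∩ S') = orbitVolume γ (integralFibre γ ∩ S) := by
  rw [← orbitVolume_conjLin_image γ u (integralFibre γ ∩ S)]
  congr 1
  ext f
  obtain ⟨f, rfl⟩ := (conjLin u).surjective f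
  rw [(conjLin u).injective.mem_set_image, Set.mem_inter_iff, Set.mem_inter_iff,
    conjLin_mem_integralFibre, h]

theorem stableOrbitalLattice_eq_stableOrbitalType (γ : Matrix (Fin n) (Fin n) 𝒪[F])
    {k : Multiset ℕ} {M : Submodule 𝒪[F] (Fin n → 𝒪[F])} (h : HasType M k) :
    stableOrbitalLattice γ M = stableOrbitalType γ k := by
  obtain ⟨u, hu⟩ := h.exists_units_map_eq h.hasType_typeRep
  rw [stableOrbitalType, ← hu]
  exact (orbitVolume_integralFibre_inter_eq γ u fun f => conjLin_mem_homSet_map u).symm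

theorem stableOrbitalSub_eq_stableOrbitalTypeCodim (γ : Matrix (Fin n) (Fin n) 𝒪[F])
    {k : Multiset ℕ} {M : Submodule 𝒪[F] (Fin n → 𝒪[F])} {t : ℕ}
    {V : Submodule (ResidueField 𝒪[F]) (Fin n → ResidueField 𝒪[F])} (h : HasType M k)
    (hV : IsSubspaceOfCodim M k t V) :
    stableOrbitalSub γ M V = stableOrbitalTypeCodim γ k t := by
  obtain ⟨u, hu⟩ := h.exists_units_map_eq h.hasType_typeRep
  have hfr : Module.finrank (ResidueField 𝒪[F]) (V.map (unitsLin (reduceUnit u) :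
      (Fin n → ResidueField 𝒪[F]) →ₗ[ResidueField 𝒪[F]] (Fin n → ResidueField 𝒪[F]))) =
      Module.finrank (ResidueField 𝒪[F]) V := LinearEquiv.finrank_map_eq _ _
  have h1 : IsSubspaceOfCodim (typeRep 𝒪[F] n k) k t (V.map (unitsLin (reduceUnit u) :
      (Fin n → ResidueField 𝒪[F]) →ₗ[ResidueField 𝒪[F]] (Fin n → ResidueField 𝒪[F]))) := by
    refine ⟨?_, by rw [hfr]; exact hV.2⟩
    rw [← hu, coe_unitsLin u, reduceLattice_map_mulVecLin]
    exact Submodule.map_mono hV.1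
  have h2 := Classical.epsilon_spec (p := fun V => IsSubspaceOfCodim (typeRep 𝒪[F] n k) k t V)
    ⟨_, h1⟩
  obtain ⟨w, hw, hwV⟩ := exists_units_map_eq_of_finrank_eq h1.1 h2.1 (by
    have := h1.2
    have := h2.2
    omega)
  have e1 := orbitVolume_integralFibre_inter_eq γ u fun f =>
    conjLin_mem_homSetSub_map u (M := M) (V := V) (f := f)
  have e2 := orbitVolume_integralFibre_inter_eq γ w fun f =>
    conjLin_mem_homSetSub_map w (M := typeRep 𝒪[F] n k) (V := V.map (unitsLin (reduceUnit u) :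
      (Fin n → ResidueField 𝒪[F]) →ₗ[ResidueField 𝒪[F]] (Fin n → ResidueField 𝒪[F]))) (f := f)
  rw [hw, hwV] at e2
  rw [hu] at e1
  exact e1.symm.trans e2.symm

theorem orbitVolume_iUnion {ι : Type*} [Fintype ι] (γ : Matrix (Fin n) (Fin n) 𝒪[F])
    {S : ι → Set (Matrix (Fin n) (Fin n) 𝒪[F])} (hS : ∀ i, IsCompact (S i))
    (hd : Pairwise (Function.onFun Disjoint S)) :
    orbitVolume γ (⋃ i, S i) = ∑ i, orbitVolume γ (S i) := by
  have hinj : Function.Injective fun f : Matrix (Fin n) (Fin n) 𝒪[F] =>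
      f.map (algebraMap 𝒪[F] F) := Matrix.map_injective Subtype.val_injective
  have hcont : Continuous fun f : Matrix (Fin n) (Fin n) 𝒪[F] => f.map (algebraMap 𝒪[F] F) :=
    continuous_id.matrix_map continuous_subtype_val
  simp only [orbitVolume]
  rw [Set.image_iUnion, measure_iUnion, tsum_fintype]
  · exact fun i j hij => (Set.disjoint_image_iff hinj).2 (hd hij)
  · exact fun i => ((hS i).image hcont).isClosed.measurableSet

theorem continuous_charCoeffs {R : Type*} [CommRing R] [TopologicalSpace R] [IsTopologicalRing R] :
    Continuous fun X : Matrix (Fin n) (Fin n) R => charCoeffs X := by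
  refine continuous_pi fun i => ?_
  have h : ∀ X : Matrix (Fin n) (Fin n) R, charCoeffs X i =
      MvPolynomial.eval (fun a : Fin n × Fin n => X a.1 a.2)
        ((Matrix.charpoly.univ R (Fin n)).coeff (n - 1 - i)) := fun X =>
    (Matrix.charpoly.univ_coeff_eval₂Hom (Fin n) (RingHom.id R) (fun a : Fin n × Fin n => X a.1 a.2)
      (n - 1 - i)).symm
  simp only [h]
  exact (MvPolynomial.continuous_eval _).comp
    (continuous_pi fun a => continuous_id.matrix_elem a.1 a.2)

omit [MeasurableSpace F] [BorelSpace F] in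
theorem isClosed_integralFibre (γ : Matrix (Fin n) (Fin n) 𝒪[F]) : IsClosed (integralFibre γ) :=
  isClosed_eq continuous_charCoeffs continuous_const

/-- `𝒮𝒪_γ` is the sum over the types `k` with `∑ kᵢ = ord c_n` of the contributions of the
lattices of type `k`, all of which are equal. -/
theorem stableOrbital_eq_sum (γ : Matrix (Fin n) (Fin n) 𝒪[F]) (d : ℕ)
    (hd : IsDiscreteValuationRing.addVal 𝒪[F] (γ.charpoly.coeff 0) = d) :
    stableOrbital γ = ∑ k : Nat.Partition d with k.parts.card ≤ n,
      (typeCount 𝒪[F] n k.parts : ℝ≥0∞) * stableOrbitalType γ k.parts := by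
  classical
  have hfin := fun k : Multiset ℕ => finite_hasType (R := 𝒪[F]) (n := n) k
  have hft := fun k : Multiset ℕ =>
    Fintype.ofFinite {M : Submodule 𝒪[F] (Fin n → 𝒪[F]) // HasType M k}
  let ι := Σ k : {k : Nat.Partition d // k.parts.card ≤ n},
    {M : Submodule 𝒪[F] (Fin n → 𝒪[F]) // HasType M k.1.parts}
  have hval : ∀ f ∈ integralFibre γ, IsDiscreteValuationRing.addVal 𝒪[F] f.det = d := by
    intro f hf
    rw [← hd, ← charpoly_eq_of_charCoeffs_eq hf,
      IsDiscreteValuationRing.addVal_eq_iff_associated, Matrix.det_eq_sign_charpoly_coeff]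
    exact associated_unit_mul_left _ _ (isUnit_one.neg.pow _)
  have hcover : integralFibre γ = ⋃ p : ι, integralFibre γ ∩ homSet p.2.1 := by
    refine Set.Subset.antisymm (fun f hf => ?_) (Set.iUnion_subset fun p => Set.inter_subset_left)
    have hdet := hval f hf
    obtain ⟨k, hk⟩ := exists_hasType_range (det_ne_zero_of_addVal_eq hdet)
    have hsum : k.sum = d := by
      have := hk.addVal_det
      rw [hdet] at this
      exact_mod_cast this.symm
    exact Set.mem_iUnion.2 ⟨⟨⟨⟨k, fun {i} hi => hk.1 i hi, hsum⟩, hk.card_le⟩, ⟨_, hk⟩⟩, hf, rfl⟩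
  rw [stableOrbital, hcover, orbitVolume_iUnion, Fintype.sum_sigma,
    ← Finset.sum_subtype_eq_sum_filter, Finset.subtype_univ]
  · refine Finset.sum_congr rfl fun k _ => ?_
    have h : ∀ M : {M : Submodule 𝒪[F] (Fin n → 𝒪[F]) // HasType M k.1.parts},
        orbitVolume γ (integralFibre γ ∩ homSet M.1) = stableOrbitalType γ k.1.parts :=
      fun M => stableOrbitalLattice_eq_stableOrbitalType γ M.2
    rw [Finset.sum_congr rfl fun M _ => h M, Finset.sum_const, Finset.card_univ, nsmul_eq_mul,
      typeCount, Nat.card_eq_fintype_card]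
  · exact fun p => (p.2.2.isCompact_homSet).inter_left (isClosed_integralFibre γ)
  · rintro ⟨⟨k, hk⟩, ⟨M, hM⟩⟩ ⟨⟨k', hk'⟩, ⟨M', hM'⟩⟩ hne
    refine Set.disjoint_left.2 fun f hf hf' => hne ?_
    obtain rfl : M = M' := hf.2.symm.trans hf'.2
    obtain rfl : k = k' := Nat.Partition.ext (hM.unique hM')
    rfl

/-- The codimension `t` of `A(K)` in the image `K` of `A` is positive if `A` is nilpotent and
`K ≠ 0`, and `t ≤ dim ker A`. -/
theorem finrank_map_of_charpoly_eq_X_pow {κ : Type*} [Field κ] {A : Matrix (Fin n) (Fin n) κ}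
    (hA : A.charpoly = Polynomial.X ^ n) {m c : ℕ}
    (hm : Module.finrank κ (LinearMap.range A.mulVecLin) = m) (hm1 : 1 ≤ m) (hc : m + c = n) :
    ∃ t ∈ Finset.Icc 1 c,
      Module.finrank κ ((LinearMap.range A.mulVecLin).map A.mulVecLin) + t = m := by
  set B := A.mulVecLin with hB
  set K := LinearMap.range B with hK
  have hle : K.map B ≤ K := by
    rw [hK]
    exact LinearMap.map_le_range
  have h1 : Module.finrank κ (K.map B) ≤ m := hm ▸ Submodule.finrank_mono hle
  have h2 : Module.finrank κ (K.map B) ≠ m := by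
    intro heq
    have hfix : K.map B = K := Submodule.eq_of_le_of_finrank_eq hle (heq.trans hm.symm)
    have hpow : ∀ j, K.map (B ^ j) = K := by
      intro j
      induction j with
      | zero => rw [pow_zero]; exact Submodule.map_id K
      | succ j ih => rw [pow_succ, Module.End.mul_eq_comp, Submodule.map_comp, hfix, ih]
    have hAn : A ^ n = 0 := by
      have := Matrix.aeval_self_charpoly A
      rwa [hA, map_pow, Polynomial.aeval_X] at this
    have hBn : B ^ n = 0 := by
      have := Matrix.toLin'_pow A n
      rw [hAn, map_zero] at this
      exact this.symm
    have := hpow n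
    rw [hBn, Submodule.map_zero] at this
    rw [← this, finrank_bot] at hm
    omega
  have h3 : Module.finrank κ (LinearMap.ker (B.domRestrict K)) ≤
      Module.finrank κ (LinearMap.ker B) := by
    rw [← Submodule.finrank_map_subtype_eq K]
    refine Submodule.finrank_mono ?_
    rintro _ ⟨x, hx, rfl⟩
    exact hx
  have h4 := (B.domRestrict K).finrank_range_add_finrank_ker
  have h5 := B.finrank_range_add_finrank_ker
  rw [LinearMap.range_domRestrict, hm] at h4
  rw [← hK, hm, Module.finrank_fin_fun] at h5
  exact ⟨m - Module.finrank κ (K.map B), Finset.mem_Icc.2 ⟨by omega, by omega⟩, by omega⟩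

theorem stableOrbitalType_eq_sum {γ : Matrix (Fin n) (Fin n) 𝒪[F]}
    (hγ : (γ.map (residue 𝒪[F])).charpoly = Polynomial.X ^ n) {k : Multiset ℕ}
    (hk : ∀ i ∈ k, 1 ≤ i) (hn : k.card < n) :
    stableOrbitalType γ k = ∑ t ∈ Finset.Icc 1 k.card,
      (subspaceCountType F n k t : ℝ≥0∞) * stableOrbitalTypeCodim γ k t := by
  classical
  obtain ⟨M₀, hM₀⟩ := exists_hasType (R := 𝒪[F]) hk hn.le
  have hM := hM₀.hasType_typeRep
  rw [stableOrbitalType]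
  simp only [subspaceCountType]
  set M := typeRep 𝒪[F] n k with hMdef
  have hfin : Finite (Submodule (ResidueField 𝒪[F]) (Fin n → ResidueField 𝒪[F])) := inferInstance
  have hft := fun t => Fintype.ofFinite
    {V : Submodule (ResidueField 𝒪[F]) (Fin n → ResidueField 𝒪[F]) // IsSubspaceOfCodim M k t V}
  let ι := Σ t : Finset.Icc 1 k.card,
    {V : Submodule (ResidueField 𝒪[F]) (Fin n → ResidueField 𝒪[F]) // IsSubspaceOfCodim M k t V}
  have hcover : integralFibre γ ∩ homSet M =
      ⋃ p : ι, integralFibre γ ∩ homSetSub M p.2.1 := by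
    refine Set.Subset.antisymm (fun f hf => ?_)
      (Set.iUnion_subset fun p f hf => ⟨hf.1, hf.2.1⟩)
    have hchar : (f.map (residue 𝒪[F])).charpoly = Polynomial.X ^ n := by
      rw [← hγ, Matrix.charpoly_map, Matrix.charpoly_map, charpoly_eq_of_charCoeffs_eq hf.1]
    have hr : reduceLattice M = LinearMap.range (f.map (residue 𝒪[F])).mulVecLin := by
      rw [← reduceLattice_range]
      exact congrArg reduceLattice hf.2.symm
    have hd := hM.finrank_reduceLattice_add_card
    obtain ⟨t, ht, hVt⟩ := finrank_map_of_charpoly_eq_X_pow hchar rfl (by rw [← hr]; omega)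
      (by rw [← hr]; exact hd)
    rw [← hr] at hVt
    refine Set.mem_iUnion.2 ⟨⟨⟨t, ht⟩,
      ⟨(reduceLattice M).map (f.map (residue 𝒪[F])).mulVecLin, ?_, ?_⟩⟩, hf.1, hf.2, rfl⟩
    · rw [hr]
      exact LinearMap.map_le_range
    · exact (congrArg (· + k.card) hVt).trans hd
  rw [stableOrbitalLattice, hcover, orbitVolume_iUnion, Fintype.sum_sigma,
    ← Finset.sum_coe_sort (Finset.Icc 1 k.card)]
  · refine Finset.sum_congr rfl fun t _ => ?_
    have h : ∀ V : {V : Submodule (ResidueField 𝒪[F]) (Fin n → ResidueField 𝒪[F]) //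
        IsSubspaceOfCodim M k t V},
        orbitVolume γ (integralFibre γ ∩ homSetSub M V.1) = stableOrbitalTypeCodim γ k t :=
      fun V => stableOrbitalSub_eq_stableOrbitalTypeCodim γ hM V.2
    rw [Finset.sum_congr rfl fun V _ => h V, Finset.sum_const, Finset.card_univ, nsmul_eq_mul,
      subspaceCount, Nat.card_eq_fintype_card]
  · exact fun p => (hM.isCompact_homSetSub _).inter_left (isClosed_integralFibre γ)
  · rintro ⟨⟨t, ht⟩, ⟨V, hV⟩⟩ ⟨⟨t', ht'⟩, ⟨V', hV'⟩⟩ hne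
    refine Set.disjoint_left.2 fun f hf hf' => hne ?_
    obtain rfl : V = V' := hf.2.2.symm.trans hf'.2.2
    obtain rfl : t = t' := by
      have h1 : _ + t + _ = _ := hV.2
      have h2 : _ + t' + _ = _ := hV'.2
      omega
    rfl

end OrbitalIntegrals

end GLOrbital
theorem mainTheorem5 (F : Type*) [Field F] [ValuativeRel F] [TopologicalSpace F]
    [IsNonarchimedeanLocalField F] [MeasurableSpace F] [BorelSpace F] (n : ℕ)
    (γ : Matrix (Fin n) (Fin n) 𝒪[F])
    (hγ : (γ.map (algebraMap 𝒪[F] F)).charpoly.Separable)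
    (d : ℕ) (hd : IsDiscreteValuationRing.addVal 𝒪[F] (γ.charpoly.coeff 0) = d) :
    -- the volume of `O_{γ, 𝓛(L, M)}` depends only on the type of `M`
    (∀ (k : Multiset ℕ) (M : Submodule 𝒪[F] (Fin n → 𝒪[F])), HasType M k →
      stableOrbitalLattice γ M = stableOrbitalType γ k) ∧
    -- the summation formula over types
    stableOrbital γ = ∑ k : Nat.Partition d with k.parts.card ≤ n,
      (typeCount 𝒪[F] n k.parts : ℝ≥0∞) * stableOrbitalType γ k.parts ∧
    -- the closed formula for the number of sublattices of a given type
    (∀ (l : ℕ) (r mult : ℕ → ℕ), r 0 = 0 → (∀ i < l, r i < r (i + 1)) →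
      (∀ i ∈ Finset.Icc 1 l, 1 ≤ mult i) → ∑ j ∈ Finset.range (l + 1), mult j = n →
      typeCount 𝒪[F] n (∑ i ∈ Finset.Icc 1 l, Multiset.replicate (mult i) (r i)) =
        ∏ i ∈ Finset.Icc 1 l,
          grCard (IsLocalRing.ResidueField 𝒪[F]) (mult i) (∑ j ∈ Finset.range (i + 1), mult j) *
          Nat.card (IsLocalRing.ResidueField 𝒪[F]) ^
            (((r i - r (i - 1) - 1) * (n - ∑ j ∈ Finset.range i, mult j) +
              (n - ∑ j ∈ Finset.range (i + 1), mult j)) * ∑ j ∈ Finset.range i, mult j)) ∧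
    -- the volume of `O_{γ, 𝓛(L, M, V)}` depends only on the type of `M` and the dimension of `V`
    (∀ (k : Multiset ℕ) (M : Submodule 𝒪[F] (Fin n → 𝒪[F])) (t : ℕ)
      (V : Submodule (IsLocalRing.ResidueField 𝒪[F]) (Fin n → IsLocalRing.ResidueField 𝒪[F])),
      HasType M k → IsSubspaceOfCodim M k t V →
      stableOrbitalSub γ M V = stableOrbitalTypeCodim γ k t) ∧
    -- the numbers `d_t` are Grassmannian counts
    (∀ (k : Multiset ℕ) (M : Submodule 𝒪[F] (Fin n → 𝒪[F])) (t : ℕ), HasType M k →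
      subspaceCount M k t = subspaceCountType F n k t ∧
      subspaceCountType F n k t =
        grCard (IsLocalRing.ResidueField 𝒪[F]) t (n - k.card)) ∧
    -- the refined summation formula, when `χ_γ` reduces to `xⁿ`
    ((γ.map (IsLocalRing.residue 𝒪[F])).charpoly = Polynomial.X ^ n →
      (∀ k : Nat.Partition d, k.parts.card < n →
        stableOrbitalType γ k.parts = ∑ t ∈ Finset.Icc 1 k.parts.card,
          (subspaceCountType F n k.parts t : ℝ≥0∞) * stableOrbitalTypeCodim γ k.parts t) ∧
      stableOrbital γ =
        (∑ k : Nat.Partition d with k.parts.card < n,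
          (typeCount 𝒪[F] n k.parts : ℝ≥0∞) * (∑ t ∈ Finset.Icc 1 k.parts.card,
            (subspaceCountType F n k.parts t : ℝ≥0∞) * stableOrbitalTypeCodim γ k.parts t)) +
        (∑ k : Nat.Partition d with k.parts.card = n,
          (typeCount 𝒪[F] n k.parts : ℝ≥0∞) * stableOrbitalType γ k.parts)) := by
  have hsum := stableOrbital_eq_sum γ d hd
  refine ⟨fun k M hM => stableOrbitalLattice_eq_stableOrbitalType γ hM, hsum,
    fun l r mult h0 hr _ hn => typeCount_formula l r mult h0 hr hn,
    fun k M t V hM hV => stableOrbitalSub_eq_stableOrbitalTypeCodim γ hM hV,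
    fun k M t hM => ⟨?_, subspaceCount_eq_grCard hM.hasType_typeRep t⟩, fun hX => ?_⟩
  · rw [subspaceCountType, subspaceCount_eq_grCard hM, subspaceCount_eq_grCard hM.hasType_typeRep]
  · have hrefine := fun k : Nat.Partition d =>
      stableOrbitalType_eq_sum hX (k := k.parts) (fun i hi => k.parts_pos hi)
    refine ⟨hrefine, ?_⟩
    rw [hsum, ← Finset.sum_filter_add_sum_filter_not _ (fun k => k.parts.card < n),
      Finset.filter_filter, Finset.filter_filter]
    congr 1
    · refine Finset.sum_congr (Finset.filter_congr fun k _ => by omega) fun k hk => ?_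
      rw [hrefine k (Finset.mem_filter.1 hk).2]
    · exact Finset.sum_congr (Finset.filter_congr fun k _ => by omega) fun k _ => rfl
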